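/- Let $d\ge 1$, let $\mathcal X=[0,1]^d$ with Lebesgue measure $\lambda_d$ and the supremum norm, let $\varphi:\mathcal X\to\mathbb R$ be continuous and put $\varphi^*=\sup_{\mathcal X}\varphi$. **Level sets.** For $A\subseteq\mathcal X$ and $\epsilon>0$ let $(A)_\epsilon=\{\mathbf x\in\mathcal X:\exists \mathbf x'\in A,\ \|\mathbf x-\mathbf x'\|_\infty\le\epsilon\}$, and say that $A$ has Minkowski content $M(A)$ if $M(A)=\lim_{\epsilon\downarrow0}\epsilon^{-1}\lambda_d((A)_\epsilon)$ exists and is finite. Assume that there is a constant $C<\infty$ such that, for every $\mathbf x\in\mathcal X$ with $\varphi(\mathbf x)<\varphi^*$, the level set $\{\mathbf x'\in\mathcal X:\varphi(\mathbf x')=\varphi(\mathbf x)\}$ has a Minkowski content and this content is at most $C$. **Kernel.** Let $K$ be a Markov kernel from $\mathcal X$ to $\mathcal X$ with a density $K(\mathbf y|\mathbf x)$ with respect to $\lambda_d$. For $i\in\{1,\dots,d\}$ let $F_{K,i}(\mathbf x,\mathbf y)$ be the value at $y_i$ of the cumulative distribution function, under $K(\mathbf x,\cdot)$, of the $i$-th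 component given that the previous components are $y_1,\dots,y_{i-1}$ (computed from the conditional densities, i.e. the quotients of marginal densities of $K(\cdot|\mathbf x)$); $F_K(\mathbf x,\cdot)=(F_{K,1}(\mathbf x,\cdot),\dots,F_{K,d}(\mathbf x,\cdot))$ is the Rosenblatt transformation of $K(\mathbf x,\cdot)$, and $F_K^{-1}(\mathbf x,\cdot):[0,1]^d\to\mathcal X$ its inverse, whose components are successively the inverse conditional distribution functions. Assume - (A1) for each $\mathbf x$, $F_{K,i}(\mathbf x,\mathbf y)$ is strictly increasing in $y_i\in[0,1]$, for $i=1,\dots,d$; - (A2) $(\mathbf x,\mathbf y)\mapsto K(\mathbf y|\mathbf x)$ is continuous on $\mathcal X^2$ and $K(\mathbf y|\mathbf x)\ge\underline K$ on $\mathcal X^2$ for a constant $\underline K>0$. **Input sequences.** Let $b\ge2$, $t\ge0$ and $R\ge 0$ be integers ($R$ finite). A sequence $(\mathbf w^n)_{n\ge0}$ in $[0,1)^s$ is a $(t,s)$-sequence in base $b$ if, for all integers $a\ge0$ and $m\ge t$, every box $\prod_{j=1}^s[a_jb^{-e_j},(a_j+1)b^{-e_j})$ with integers $e_j\ge0$,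 $0\le a_j<b^{e_j}$ and volume $b^{t-m}$ contains exactly $b^t$ of the points $\mathbf w^n$, $ab^m\le n<(a+1)b^m$. Let $(v^n)_{n\ge0}$ be a $(0,1)$-sequence in base $b$ with $v^0=0$, and let $(\mathbf u_R^n)_{n\ge0}$ be a $(t,d)_R$-sequence in base $b$, that is $$u^n_{R,i}=\sum_{k=1}^{R}a^n_{ki}b^{-k}+b^{-R}z^n_i,\qquad 1\le i\le d,\ n\ge0,$$ where the $z_i^n$ are i.i.d. uniform on $[0,1)$ and the deterministic digits $a_{ki}^n\in\{0,\dots,b-1\}$ are such that the points with coordinates $\sum_{k=1}^{\infty}a^n_{ki}b^{-k}$ form a $(t,d)$-sequence in base $b$. **Algorithm (QMC-SA).** Start from $\mathbf x^0\in\mathcal X$. For $n\ge1$ let $\mathbf y^n=F_K^{-1}(\mathbf x^{n-1},\mathbf u_R^n)$, and set $\mathbf x^n=\mathbf y^n$ if $v^n\le\exp\{(\varphi(\mathbf y^n)-\varphi(\mathbf x^{n-1}))/T_n\}$, and $\mathbf x^n=\mathbf x^{n-1}$ otherwise. Here $(T_n)_{n\ge1}$ is positive and non-increasing; it may be adaptive,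 i.e. $T_{n}$ may be a measurable function of $(\mathbf x^0,\dots,\mathbf x^{n-1})$ (deterministic schedules are a special case). **Theorem.** If $\sum_{n\ge1}T_n\log n<\infty$ (almost surely, when the schedule is adaptive), then $\varphi(\mathbf x^n)\to\varphi^*$ almost surely as $n\to\infty$. -/

import Mathlib

open MeasureTheory ProbabilityTheory Set Filter Topology

noncomputable section

namespace QMCSA

/-- The unit cube `[0,1]^d`. Its distance is the supremum distance, and its `volume` is the
Lebesgue measure on `[0,1]^d`. -/
abbrev Cube (d : ℕ) : Type := Fin d → unitInterval

/-! ### Rosenblatt transformation of a distribution on the cube with a given density -/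

/-- The marginal density at `(y_1, …, y_i)` of the first `i` components of a random vector with
density `p`. The coordinates of `z` of index less than `i` do not enter the integrand, so that
this is the integral of `p` over the last `d - i` coordinates. -/
def marginalDensity {d : ℕ} (p : Cube d → ℝ) (i : ℕ) (y : Cube d) : ℝ :=
  ∫ z : Cube d, p (fun j => if (j : ℕ) < i then y j else z j)

/-- The density at `y_i` of the `i`-th component conditionally on the previous components
being `(y_1, …, y_{i-1})`. -/
def condDensity {d : ℕ} (p : Cube d → ℝ) (i : Fin d) (y : Cube d) : ℝ :=
  marginalDensity p ((i : ℕ) + 1) y / marginalDensity p (i : ℕ) y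

/-- The cumulative distribution function, at `s`, of the `i`-th component conditionally on the
previous components being those of `y` (the other components of `y` play no role). -/
def rosenblattCDF {d : ℕ} (p : Cube d → ℝ) (i : Fin d) (y : Cube d) (s : unitInterval) : ℝ :=
  ∫ r in Set.Iic s, condDensity p i (Function.update y i r)

/-- The Rosenblatt transformation `F_π` of the distribution `π` with density `p`. -/
def rosenblatt {d : ℕ} (p : Cube d → ℝ) (y : Cube d) : Fin d → ℝ :=
  fun i => rosenblattCDF p i y (y i)

/-- The inverse Rosenblatt transformation `F_π⁻¹` of the distribution `π` with density `p`: the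
`i`-th component is the inverse cumulative distribution function, at `u_i`, of the `i`-th component
conditionally on the previous ones, these being the components already obtained. -/
def rosenblattInv {d : ℕ} (p : Cube d → ℝ) (u : Fin d → ℝ) (i : Fin d) : unitInterval :=
  sInf {s : unitInterval |
    u i ≤ rosenblattCDF p i (fun j => if _h : j < i then rosenblattInv p u j else 0) s}
termination_by (i : ℕ)

/-! ### Assumptions on the Markov kernel -/

/-- `k x` is a density of `K x` with respect to the Lebesgue measure, for every `x`. -/
def IsKernelDensity {d : ℕ} (K : Kernel (Cube d) (Cube d)) (k : Cube d → Cube d → ℝ) : Prop :=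
  ∀ x, (∀ y, 0 ≤ k x y) ∧ K x = volume.withDensity (fun y => ENNReal.ofReal (k x y))

/-- For every `x`, the `i`-th component of `F_K(x, y)` is strictly increasing in `y_i`. -/
def AssumptionA1 {d : ℕ} (k : Cube d → Cube d → ℝ) : Prop :=
  ∀ (x y : Cube d) (i : Fin d),
    StrictMono (fun s : unitInterval => rosenblatt (k x) (Function.update y i s) i)

/-- The density is continuous in both variables and bounded below by a positive constant. -/
def AssumptionA2 {d : ℕ} (k : Cube d → Cube d → ℝ) : Prop :=
  Continuous (fun q : Cube d × Cube d => k q.1 q.2) ∧ ∃ c : ℝ, 0 < c ∧ ∀ x y, c ≤ k x y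

/-! ### Minkowski content -/

/-- The closed `ε`-neighbourhood of `A` in the cube, for the supremum distance. -/
def thickened {d : ℕ} (A : Set (Cube d)) (ε : ℝ) : Set (Cube d) :=
  {x | ∃ x' ∈ A, dist x x' ≤ ε}

/-- The set `A` has the (finite) `(d-1)`-dimensional Minkowski content `M`. -/
def HasMinkowskiContent {d : ℕ} (A : Set (Cube d)) (M : ℝ) : Prop :=
  Tendsto (fun ε : ℝ => ε⁻¹ * (volume (thickened A ε)).toReal) (𝓝[>] 0) (𝓝 M)

/-! ### Nets and sequences -/

/-- The `b`-ary box `∏_j [a_j b^{-e_j}, (a_j + 1) b^{-e_j})`. -/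
def elementaryBox {s : ℕ} (b : ℕ) (a e : Fin s → ℕ) : Set (Fin s → ℝ) :=
  {w | ∀ j, (a j : ℝ) / (b : ℝ) ^ e j ≤ w j ∧ w j < ((a j : ℝ) + 1) / (b : ℝ) ^ e j}

/-- The points `(p n)`, `n < b ^ m`, form a `(t, m, s)`-net in base `b`: they are in `[0,1)^s`,
and every `b`-ary box of volume `b ^ (t - m)` contains exactly `b ^ t` of them. -/
def IsNet (b t m : ℕ) {s : ℕ} (p : Fin (b ^ m) → Fin s → ℝ) : Prop :=
  (∀ n j, p n j ∈ Set.Ico (0 : ℝ) 1) ∧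
  ∀ a e : Fin s → ℕ, (∀ j, a j < b ^ e j) →
    (∏ j, ((b : ℝ) ^ e j)⁻¹) = (b : ℝ) ^ ((t : ℤ) - (m : ℤ)) →
    {n | p n ∈ elementaryBox b a e}.ncard = b ^ t

/-- The sequence `(w n)`, `n ≥ 0`, is a `(t, s)`-sequence in base `b`. -/
def IsTSSequence (b t : ℕ) {s : ℕ} (w : ℕ → Fin s → ℝ) : Prop :=
  ∀ a m : ℕ, t ≤ m → IsNet b t m (fun n : Fin (b ^ m) => w (a * b ^ m + (n : ℕ)))

/-- The random sequence `(u n)`, `n ≥ 0`, is a `(t, s)_R`-sequence in base `b`: the first `R`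
digits are those of a deterministic `(t, s)`-sequence, the remainder is uniformly distributed,
independently over `n` and over the coordinates. The digit of rank `k + 1` is `a n i k`. -/
def IsTSRSequence {Ω : Type*} [MeasurableSpace Ω] (P : Measure Ω) (b t R : ℕ) {s : ℕ}
    (u : ℕ → Ω → Fin s → ℝ) : Prop :=
  ∃ (a : ℕ → Fin s → ℕ → Fin b) (z : ℕ × Fin s → Ω → ℝ),
    IsTSSequence b t (fun n i => ∑' k : ℕ, ((a n i k : ℕ) : ℝ) / (b : ℝ) ^ (k + 1)) ∧
    (∀ q, Measurable (z q)) ∧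
    (∀ q, pdf.IsUniform (z q) (Set.Ico (0 : ℝ) 1) P volume) ∧
    iIndepFun z P ∧
    ∀ n ω i, u n ω i =
      (∑ k ∈ Finset.range R, ((a n i k : ℕ) : ℝ) / (b : ℝ) ^ (k + 1)) + z (n, i) ω / (b : ℝ) ^ R

/-! ### The algorithm -/

/-- `x` is the trajectory of the algorithm for the objective `φ`, the kernel with density `k`, the
starting point `x₀`, the input sequences `u` and `v`, and the temperatures `T 1, T 2, …`
(`T 0`, `u 0` and `v 0` are not used). -/
structure IsRun {d : ℕ} (φ : Cube d → ℝ) (k : Cube d → Cube d → ℝ) (x₀ : Cube d)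
    (u : ℕ → Fin d → ℝ) (v : ℕ → ℝ) (T : ℕ → ℝ) (x : ℕ → Cube d) : Prop where
  start : x 0 = x₀
  temp_pos : ∀ n, 1 ≤ n → 0 < T n
  temp_antitone : ∀ n, 1 ≤ n → T (n + 1) ≤ T n
  accept : ∀ n, v (n + 1) ≤
      Real.exp ((φ (rosenblattInv (k (x n)) (u (n + 1))) - φ (x n)) / T (n + 1)) →
    x (n + 1) = rosenblattInv (k (x n)) (u (n + 1))
  reject : ∀ n, Real.exp ((φ (rosenblattInv (k (x n)) (u (n + 1))) - φ (x n)) / T (n + 1)) <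
      v (n + 1) →
    x (n + 1) = x n

end QMCSA

end

/-!
Three facts carry the proof.

*The values converge.* Since `v 0 = 0` and `v` is a `(0,1)`-sequence, `v n ≥ 1 / (b n)` for `n ≥ 1`, so
that an accepted move decreases `φ` by at most `T n * log (b n)`. These bounds are summable, hence
`φ (x n)` converges almost surely, to a random limit (`IsRun.exists_tendsto`). It remains to
exclude limits below the maximum of `φ`.

*Proposals have a density, and reach every set at some step of each block.* The inverse Rosenblatt
transformation maps the uniform distribution to `K x` (`map_rosenblattInv`, by Fubini's theorem, one
coordinate at a time). The first `R` digits of `u n` are deterministic, and given them `u n` is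
uniform on a cube of side `b ^ (-R)`. Hence the proposal made from a fixed point `x` is in a set `A` with
probability at most `b ^ (R d) sup k` times the volume of `A` (`measure_proposal_mem_le`). Conversely,
in a block of `b ^ (t + d (R + 1))` steps all those cubes are visited, among them one in which the
inverse image of `A` has at least its overall proportion; at that step the proposal from `x` is in `A`
with probability at least `inf k` times the volume of `A`, whatever `x`
(`exists_le_measure_proposal_mem`).

*No level below the maximum is a limit.* A set with a Minkowski content is negligible, so a level `l`
below the maximum has a neighbourhood `W` such that `φ ⁻¹' W` has a volume as small as desired. If
the values stay in `W` during a block, then either one of the proposals made from the initial point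
of the block falls in `φ ⁻¹' W`, which is unlikely, or the trajectory does not move at all and misses the
superlevel set above `W` throughout the block, an event of probability bounded away from `1`
(`IsRun.block`). The inputs of the block are independent of the past, so these
bounds hold conditionally on the past and multiply over successive blocks: almost surely the values do
not stay in `W` forever (`exists_window_null`). Countably many such windows cover all levels below the
maximum.
-/

namespace QMCSA

/-! ### Resampling one coordinate of a product measure -/

/-- Replacing one coordinate of a random vector with independent components by a fresh independent
copy of that component does not change the law of the vector. -/
lemma measurePreserving_update {ι : Type*} [Fintype ι] [DecidableEq ι] {α : ι → Type*}
    [∀ i, MeasurableSpace (α i)] (μ : ∀ i, Measure (α i)) [∀ i, IsProbabilityMeasure (μ i)]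
    (i : ι) :
    MeasurePreserving (fun q : (∀ j, α j) × α i => Function.update q.1 i q.2)
      ((Measure.pi μ).prod (μ i)) (Measure.pi μ) := by
  have hm : Measurable (fun q : (∀ j, α j) × α i => Function.update q.1 i q.2) :=
    measurable_update'
  refine ⟨hm, (Measure.pi_eq fun s hs => ?_).symm⟩
  rw [Measure.map_apply hm (MeasurableSet.univ_pi hs)]
  have : (fun q : (∀ j, α j) × α i => Function.update q.1 i q.2) ⁻¹' (univ.pi s) =
      (univ.pi (Function.update s i univ)) ×ˢ s i := by
    ext ⟨y, r⟩
    simp only [mem_preimage, Set.mem_pi, mem_univ, true_implies, mem_prod]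
    constructor
    · intro h
      refine ⟨fun j => ?_, by simpa using h i⟩
      by_cases hj : j = i
      · subst hj; simp
      · simpa [hj] using h j
    · rintro ⟨h1, h2⟩ j
      by_cases hj : j = i
      · subst hj; simpa using h2
      · simpa [hj] using h1 j
  rw [this, Measure.prod_prod, Measure.pi_pi, ← Finset.prod_erase_mul _ _ (Finset.mem_univ i),
    ← Finset.prod_erase_mul Finset.univ (fun j => (μ j) (s j)) (Finset.mem_univ i)]
  simp only [Function.update_self, measure_univ, mul_one]
  congr 1
  refine Finset.prod_congr rfl fun j hj => ?_
  rw [Function.update_of_ne (Finset.ne_of_mem_erase hj)]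

lemma lintegral_update {ι : Type*} [Fintype ι] [DecidableEq ι] {α : ι → Type*}
    [∀ i, MeasurableSpace (α i)] (μ : ∀ i, Measure (α i)) [∀ i, IsProbabilityMeasure (μ i)]
    (i : ι) {g : (∀ j, α j) → ENNReal} (hg : Measurable g) :
    ∫⁻ y, ∫⁻ r, g (Function.update y i r) ∂μ i ∂Measure.pi μ = ∫⁻ y, g y ∂Measure.pi μ := by
  refine Eq.trans ?_ ((measurePreserving_update μ i).lintegral_comp hg)
  exact (lintegral_prod (fun q : (∀ j, α j) × α i => g (Function.update q.1 i q.2))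
    (hg.comp (measurePreserving_update μ i).measurable).aemeasurable).symm

/-! ### The inverse transform in dimension one -/

section Quantile

variable {f : unitInterval → ℝ}

lemma continuous_setIntegral_Iic (hf : Continuous f) (h0 : ∀ r, 0 ≤ f r) :
    Continuous (fun s : unitInterval => ∫ r in Iic s, f r) := by
  obtain ⟨M, hM⟩ := isCompact_univ.bddAbove_image hf.continuousOn
  have hM' : ∀ r, f r ≤ M := fun r => hM (mem_image_of_mem f (mem_univ r))
  have hi : Integrable f := hf.integrable_of_hasCompactSupport (HasCompactSupport.of_compactSpace f)
  refine (LipschitzWith.of_le_add_mul M.toNNReal fun x y => ?_).continuous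
  rcases le_total x y with h | h
  · have h1 : ∫ r in Iic x, f r ≤ ∫ r in Iic y, f r :=
      setIntegral_mono_set hi.integrableOn (ae_of_all _ h0) (Iic_subset_Iic.2 h).eventuallyLE
    have h2 : 0 ≤ (M.toNNReal : ℝ) * dist x y := by positivity
    linarith
  · rw [← Iic_union_Ioc_eq_Iic h, setIntegral_union (Iic_disjoint_Ioc le_rfl) measurableSet_Ioc
      hi.integrableOn hi.integrableOn]
    gcongr
    calc ∫ r in Ioc y x, f r ≤ ∫ r in Ioc y x, M :=
          setIntegral_mono hi.integrableOn (integrable_const _).integrableOn hM'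
      _ = M * dist x y := by
          have h' : (y : ℝ) ≤ x := h
          rw [setIntegral_const, Measure.real, unitInterval.volume_Ioc, smul_eq_mul, mul_comm,
            Subtype.dist_eq, Real.dist_eq, abs_of_nonneg (by linarith),
            ENNReal.toReal_ofReal (by linarith)]
      _ ≤ M.toNNReal * dist x y := by gcongr; exact Real.le_coe_toNNReal M

lemma monotone_setIntegral_Iic (hf : Continuous f) (h0 : ∀ r, 0 ≤ f r) :
    Monotone (fun s : unitInterval => ∫ r in Iic s, f r) := fun _ _ h =>
  setIntegral_mono_set
    (hf.integrable_of_hasCompactSupport (HasCompactSupport.of_compactSpace f)).integrableOn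
    (ae_of_all _ h0) (Iic_subset_Iic.2 h).eventuallyLE

/-- The Galois connection between a continuous distribution function and its inverse. -/
lemma sInf_setOf_le_iff {G : unitInterval → ℝ} (hG : Continuous G) (hm : Monotone G) {r : ℝ}
    {s : unitInterval} (h : r ≤ G 1 ∨ s < 1) :
    sInf {s' | r ≤ G s'} ≤ s ↔ r ≤ G s := by
  refine ⟨fun hs => ?_, fun hs => sInf_le hs⟩
  have hne : {s' | r ≤ G s'}.Nonempty := by
    rcases h with h | h
    · exact ⟨1, h⟩
    · by_contra hne
      rw [not_nonempty_iff_eq_empty] at hne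
      rw [hne, sInf_empty] at hs
      exact absurd (hs.trans_lt h) (not_lt_of_ge le_top)
  have hmem : sInf {s' | r ≤ G s'} ∈ {s' | r ≤ G s'} :=
    (isClosed_le continuous_const hG).csInf_mem hne (OrderBot.bddBelow _)
  exact le_trans hmem (hm hs)

/-- Inverse transform sampling: the inverse distribution function of a continuous density maps the
uniform distribution to the distribution with that density. -/
lemma map_quantile (hf : Continuous f) (h0 : ∀ r, 0 ≤ f r) (h1 : ∫ r, f r = 1) :
    Measurable (fun r : ℝ => sInf {s : unitInterval | r ≤ ∫ r' in Iic s, f r'}) ∧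
    Measure.map (fun r : ℝ => sInf {s : unitInterval | r ≤ ∫ r' in Iic s, f r'})
      (volume.restrict (Ico 0 1)) = volume.withDensity (fun r => ENNReal.ofReal (f r)) := by
  set G : unitInterval → ℝ := fun s => ∫ r' in Iic s, f r' with hG
  have hGc : Continuous G := continuous_setIntegral_Iic hf h0
  have hGm : Monotone G := monotone_setIntegral_Iic hf h0
  have hi : Integrable f := hf.integrable_of_hasCompactSupport (HasCompactSupport.of_compactSpace f)
  have hG1 : G 1 = 1 := by
    have : Iic (1 : unitInterval) = univ := Iic_top
    simp [hG, this, h1]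
  have hG0 : ∀ s, 0 ≤ G s := fun s => integral_nonneg h0
  have hmeas : Measurable (fun r : ℝ => sInf {s : unitInterval | r ≤ G s}) := by
    refine measurable_of_Iic fun s => ?_
    rcases eq_or_ne s 1 with rfl | hs
    · have : Iic (1 : unitInterval) = univ := Iic_top
      simp [this]
    · have : (fun r : ℝ => sInf {s : unitInterval | r ≤ G s}) ⁻¹' Iic s = Iic (G s) := by
        ext r
        exact sInf_setOf_le_iff hGc hGm (Or.inr (lt_of_le_of_ne le_top hs))
      rw [this]
      exact measurableSet_Iic
  refine ⟨hmeas, Measure.ext_of_Iic _ _ fun s => ?_⟩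
  have hpre : (fun r : ℝ => sInf {s : unitInterval | r ≤ G s}) ⁻¹' Iic s ∩ Ico 0 1 =
      Iic (G s) ∩ Ico 0 1 := by
    ext r
    refine and_congr_left fun hr => ?_
    exact sInf_setOf_le_iff hGc hGm (Or.inl (hG1 ▸ hr.2.le))
  rw [Measure.map_apply hmeas measurableSet_Iic,
    Measure.restrict_apply (hmeas measurableSet_Iic), hpre,
    withDensity_apply _ measurableSet_Iic,
    ← ofReal_integral_eq_lintegral_ofReal hi.integrableOn (ae_of_all _ h0)]
  change _ = ENNReal.ofReal (G s)
  have hle : G s ≤ 1 := hG1 ▸ hGm le_top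
  apply le_antisymm
  · calc volume (Iic (G s) ∩ Ico 0 1) ≤ volume (Icc 0 (G s)) :=
        measure_mono fun r hr => ⟨hr.2.1, hr.1⟩
      _ = _ := by simp
  · calc ENNReal.ofReal (G s) = volume (Ico 0 (G s)) := by simp
      _ ≤ _ := measure_mono (t := Iic (G s) ∩ Ico 0 1) fun r hr =>
          ⟨hr.2.le, hr.1, hr.2.trans_le hle⟩

end Quantile

/-! ### Marginal and conditional densities -/

section Density

variable {d : ℕ}

lemma splice_update (i : Fin d) (y z : Cube d) (r : unitInterval) :
    (fun j : Fin d => if (j : ℕ) < (i : ℕ) + 1 then Function.update y i r j else z j) =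
      fun j : Fin d => if (j : ℕ) < (i : ℕ) then y j else Function.update z i r j := by
  funext j
  rcases lt_trichotomy j i with h | h | h
  · have h' : (j : ℕ) < i := h
    simp [h', Nat.lt_succ_of_lt h', h.ne]
  · subst h; simp
  · have h' : (i : ℕ) < j := h
    simp [not_lt.2 h'.le, Nat.not_lt.2 (Nat.succ_le_of_lt h'), h.ne']

lemma marginalDensity_congr (p : Cube d → ℝ) (i : ℕ) {y y' : Cube d}
    (h : ∀ j : Fin d, (j : ℕ) < i → y j = y' j) :
    marginalDensity p i y = marginalDensity p i y' := by
  unfold marginalDensity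
  congr 1
  funext z
  congr 1
  funext j
  split_ifs with hj
  · exact h j hj
  · rfl

lemma condDensity_update_congr (p : Cube d → ℝ) (i : Fin d) {y y' : Cube d}
    (h : ∀ j, j < i → y j = y' j) (r : unitInterval) :
    condDensity p i (Function.update y i r) = condDensity p i (Function.update y' i r) := by
  have key : ∀ j : Fin d, (j : ℕ) < i + 1 →
      Function.update y i r j = Function.update y' i r j := by
    intro j hj
    rcases eq_or_ne j i with rfl | hne
    · simp
    · simpa [hne] using h j (lt_of_le_of_ne (Nat.lt_succ_iff.1 hj) hne)
  rw [condDensity, condDensity, marginalDensity_congr p _ key,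
    marginalDensity_congr p (i : ℕ) fun j hj => key j (Nat.lt_succ_of_lt hj)]

lemma rosenblattCDF_congr (p : Cube d → ℝ) (i : Fin d) {y y' : Cube d}
    (h : ∀ j, j < i → y j = y' j) : rosenblattCDF p i y = rosenblattCDF p i y' := by
  funext s
  simp only [rosenblattCDF, condDensity_update_congr p i h]

variable {X : Type*} [TopologicalSpace X] [FirstCountableTopology X] [LocallyCompactSpace X]
  {k : X → Cube d → ℝ}

lemma continuous_marginalDensity (hk : Continuous fun q : X × Cube d => k q.1 q.2) (i : ℕ) :
    Continuous (fun q : X × Cube d => marginalDensity (k q.1) i q.2) := by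
  have : Continuous (Function.uncurry fun (q : X × Cube d) (z : Cube d) =>
      k q.1 (fun j => if (j : ℕ) < i then q.2 j else z j)) := by
    have h2 : Continuous fun w : (X × Cube d) × Cube d =>
        (fun j => if (j : ℕ) < i then w.1.2 j else w.2 j : Cube d) := by
      refine continuous_pi fun j => ?_
      split_ifs <;> fun_prop
    have h1 : Continuous fun w : (X × Cube d) × Cube d => w.1.1 := by fun_prop
    exact hk.comp (h1.prodMk h2)
  simpa [marginalDensity] using
    continuous_parametric_integral_of_continuous (μ := (volume : Measure (Cube d))) this
      isCompact_univ

variable {p : Cube d → ℝ}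

lemma continuous_marginalDensity_single (hp : Continuous p) (i : ℕ) :
    Continuous (marginalDensity p i) :=
  (continuous_marginalDensity (X := Unit) (k := fun _ => p) (by fun_prop) i).comp
    (Continuous.prodMk_right ())

lemma integrable_of_continuous (hp : Continuous p) : Integrable p :=
  hp.integrable_of_hasCompactSupport (HasCompactSupport.of_compactSpace p)

lemma marginalDensity_pos (hp : Continuous p) {c : ℝ} (hc : 0 < c) (hpc : ∀ y, c ≤ p y)
    (i : ℕ) (y : Cube d) : 0 < marginalDensity p i y := by
  have hcont : Continuous (fun z : Cube d =>
      p (fun j => if (j : ℕ) < i then y j else z j)) := by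
    refine hp.comp (continuous_pi fun j => ?_)
    split_ifs <;> fun_prop
  calc 0 < c := hc
    _ = ∫ _ : Cube d, c := by simp
    _ ≤ _ := integral_mono (integrable_const _) (integrable_of_continuous hcont) fun z => hpc _

/-- Integrating the marginal density of the first `i + 1` components over the last of them gives
the marginal density of the first `i` components. -/
lemma integral_marginalDensity_update (hp : Continuous p) (i : Fin d) (y : Cube d) :
    ∫ r, marginalDensity p ((i : ℕ) + 1) (Function.update y i r) = marginalDensity p i y := by
  set g : Cube d → ℝ := fun z => p (fun j => if (j : ℕ) < i then y j else z j) with hg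
  have hgc : Continuous g := by
    refine hp.comp (continuous_pi fun j => ?_)
    split_ifs <;> fun_prop
  have hup : Continuous fun q : Cube d × unitInterval => Function.update q.1 i q.2 := by
    fun_prop
  have hmp := measurePreserving_update (fun _ : Fin d => (volume : Measure unitInterval)) i
  have h1 : ∀ r, marginalDensity p ((i : ℕ) + 1) (Function.update y i r) =
      ∫ z : Cube d, g (Function.update z i r) := fun r => by
    simp only [marginalDensity, splice_update, hg]
  simp only [h1]
  have hint : Integrable (fun q : Cube d × unitInterval => g (Function.update q.1 i q.2))
      (volume.prod volume) :=
    (hgc.comp hup).integrable_of_hasCompactSupport (HasCompactSupport.of_compactSpace _)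
  rw [← integral_prod_symm _ hint]
  have h2 : ∫ q, g (Function.update q.1 i q.2) ∂((volume : Measure (Cube d)).prod volume) =
      ∫ z, g z ∂(Measure.map (fun q : Cube d × unitInterval => Function.update q.1 i q.2)
        (volume.prod volume)) :=
    (integral_map hup.measurable.aemeasurable hgc.aestronglyMeasurable).symm
  rw [h2, show Measure.map (fun q : Cube d × unitInterval => Function.update q.1 i q.2)
        (volume.prod volume) = volume from hmp.map_eq]
  rfl

lemma condDensity_update_eq (i : Fin d) (y : Cube d) (r : unitInterval) :
    condDensity p i (Function.update y i r) =
      marginalDensity p ((i : ℕ) + 1) (Function.update y i r) / marginalDensity p i y := by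
  rw [condDensity]
  congr 1
  refine marginalDensity_congr p _ fun j hj => ?_
  rw [Function.update_of_ne (fun h => by subst h; exact lt_irrefl _ hj)]

lemma integral_condDensity_update (hp : Continuous p) {c : ℝ} (hc : 0 < c) (hpc : ∀ y, c ≤ p y)
    (i : Fin d) (y : Cube d) : ∫ r, condDensity p i (Function.update y i r) = 1 := by
  simp only [condDensity_update_eq, integral_div, integral_marginalDensity_update hp]
  exact div_self (marginalDensity_pos hp hc hpc _ _).ne'

lemma continuous_condDensity (hk : Continuous fun q : X × Cube d => k q.1 q.2) {c : ℝ}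
    (hc : 0 < c) (hkc : ∀ x y, c ≤ k x y) (i : Fin d) :
    Continuous (fun q : X × Cube d => condDensity (k q.1) i q.2) :=
  (continuous_marginalDensity hk _).div (continuous_marginalDensity hk _) fun q =>
    (marginalDensity_pos (by fun_prop) hc (hkc q.1) _ _).ne'

lemma continuous_condDensity_update (hp : Continuous p) {c : ℝ} (hc : 0 < c)
    (hpc : ∀ y, c ≤ p y) (i : Fin d) (y : Cube d) :
    Continuous fun r => condDensity p i (Function.update y i r) :=
  (continuous_condDensity (X := Unit) (k := fun _ => p) (by fun_prop) hc (fun _ => hpc) i).comp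
    (Continuous.prodMk continuous_const (by fun_prop) :
      Continuous fun r => ((), Function.update y i r))

lemma condDensity_nonneg (hp : Continuous p) {c : ℝ} (hc : 0 < c) (hpc : ∀ y, c ≤ p y)
    (i : Fin d) (y : Cube d) : 0 ≤ condDensity p i y :=
  div_nonneg (marginalDensity_pos hp hc hpc _ _).le (marginalDensity_pos hp hc hpc _ _).le

lemma continuous_rosenblattCDF (hk : Continuous fun q : X × Cube d => k q.1 q.2) {c : ℝ}
    (hc : 0 < c) (hkc : ∀ x y, c ≤ k x y) (i : Fin d) (s : unitInterval) :
    Continuous (fun q : X × Cube d => rosenblattCDF (k q.1) i q.2 s) := by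
  have : Continuous (Function.uncurry fun (q : X × Cube d) (r : unitInterval) =>
      condDensity (k q.1) i (Function.update q.2 i r)) :=
    (continuous_condDensity hk hc hkc i).comp
      (Continuous.prodMk (by fun_prop) (by fun_prop) :
        Continuous fun w : (X × Cube d) × unitInterval => (w.1.1, Function.update w.1.2 i w.2))
  exact continuous_parametric_integral_of_continuous this isClosed_Iic.isCompact

/-! ### The inverse Rosenblatt transformation -/

lemma rosenblattInv_eq (p : Cube d → ℝ) (u : Fin d → ℝ) (i : Fin d) :
    rosenblattInv p u i =
      sInf {s : unitInterval | u i ≤ rosenblattCDF p i (rosenblattInv p u) s} := by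
  rw [rosenblattInv]
  congr! 4 with s
  refine congrFun ?_ s
  exact rosenblattCDF_congr p i fun j hj => by simp [hj]

lemma rosenblattInv_congr (p : Cube d → ℝ) {u u' : Fin d → ℝ} (i : Fin d)
    (h : ∀ j, j ≤ i → u j = u' j) : rosenblattInv p u i = rosenblattInv p u' i := by
  induction i using WellFoundedLT.induction with
  | _ i ih =>
    rw [rosenblattInv_eq, rosenblattInv_eq p u', h i le_rfl,
      rosenblattCDF_congr p i fun j hj => ih j hj fun l hl => h l (hl.trans hj.le)]

lemma measurable_rosenblattInv [SecondCountableTopology X] [MeasurableSpace X]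
    [OpensMeasurableSpace X] (hk : Continuous fun q : X × Cube d => k q.1 q.2) {c : ℝ}
    (hc : 0 < c) (hkc : ∀ x y, c ≤ k x y) :
    Measurable (fun q : X × (Fin d → ℝ) => rosenblattInv (k q.1) q.2) := by
  refine measurable_pi_lambda _ fun i => ?_
  induction i using WellFoundedLT.induction with
  | _ i ih =>
    have hlow : Measurable (fun q : X × (Fin d → ℝ) =>
        (q.1, (fun j => if j < i then rosenblattInv (k q.1) q.2 j else 0 : Cube d))) := by
      refine measurable_fst.prodMk (measurable_pi_lambda _ fun j => ?_)
      by_cases hj : j < i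
      · simpa [hj] using ih j hj
      · simp [hj]
    refine measurable_of_Iic fun s => ?_
    rcases eq_or_ne s 1 with rfl | hs
    · have : Iic (1 : unitInterval) = univ := Iic_top
      simp [this]
    · have : (fun q : X × (Fin d → ℝ) => rosenblattInv (k q.1) q.2 i) ⁻¹' Iic s =
          {q | q.2 i ≤ rosenblattCDF (k q.1) i
            (fun j => if j < i then rosenblattInv (k q.1) q.2 j else 0) s} := by
        ext q
        have hp : Continuous (k q.1) := by fun_prop
        rw [mem_preimage, mem_Iic, rosenblattInv_eq]
        rw [rosenblattCDF_congr (k q.1) i (y := rosenblattInv (k q.1) q.2)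
          (y' := fun j => if j < i then rosenblattInv (k q.1) q.2 j else 0)
          (fun j hj => by simp [hj])]
        exact sInf_setOf_le_iff
          (continuous_setIntegral_Iic (continuous_condDensity_update hp hc (hkc _) i _)
            fun _ => condDensity_nonneg hp hc (hkc _) _ _)
          (monotone_setIntegral_Iic (continuous_condDensity_update hp hc (hkc _) i _)
            fun _ => condDensity_nonneg hp hc (hkc _) _ _)
          (Or.inr (lt_of_le_of_ne le_top hs))
      rw [this]
      exact measurableSet_le (by fun_prop)
        ((continuous_rosenblattCDF hk hc hkc i s).measurable.comp hlow)

lemma measurable_rosenblattInv_single (hp : Continuous p) {c : ℝ} (hc : 0 < c)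
    (hpc : ∀ y, c ≤ p y) : Measurable (rosenblattInv p) :=
  (measurable_rosenblattInv (X := Unit) (k := fun _ => p) (by fun_prop) hc fun _ => hpc).comp
    (measurable_const.prodMk measurable_id : Measurable fun u : Fin d → ℝ => ((), u))

/-- The uniform distribution on `[0,1)^d`. -/
noncomputable abbrev uniformMeasure (d : ℕ) : Measure (Fin d → ℝ) :=
  Measure.pi fun _ => volume.restrict (Ico (0 : ℝ) 1)

instance : IsProbabilityMeasure ((volume : Measure ℝ).restrict (Ico (0 : ℝ) 1)) :=
  ⟨by simp⟩

/-- The law of the first `i` components of `F_p⁻¹(u)`, with `u` uniform, has density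
`marginalDensity p i`. This is proved by induction on `i`, resampling the component `u_i`. -/
lemma lintegral_rosenblattInv_of_dependsOn (hp : Continuous p) {c : ℝ} (hc : 0 < c)
    (hpc : ∀ y, c ≤ p y) (h1 : ∫ y, p y = 1) (i : ℕ) (hi : i ≤ d) (g : Cube d → ENNReal)
    (hg : Measurable g)
    (hgi : ∀ y y' : Cube d, (∀ j : Fin d, (j : ℕ) < i → y j = y' j) → g y = g y') :
    ∫⁻ u, g (rosenblattInv p u) ∂uniformMeasure d =
      ∫⁻ y, g y * ENNReal.ofReal (marginalDensity p i y) := by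
  have hX := measurable_rosenblattInv_single hp hc hpc
  induction i generalizing g with
  | zero =>
    have hconst : ∀ y, g y = g 0 := fun y => hgi y 0 (by simp)
    simp [hconst, marginalDensity, h1]
  | succ n ih =>
    set i : Fin d := ⟨n, hi⟩ with hidef
    set h : Cube d → ENNReal := fun y => ∫⁻ s : unitInterval,
      g (Function.update y i s) * ENNReal.ofReal (condDensity p i (Function.update y i s)) with hh
    have hcd : Measurable (condDensity p i) :=
      ((continuous_condDensity (X := Unit) (k := fun _ => p) (by fun_prop) hc
        (fun _ => hpc) i).comp (Continuous.prodMk_right ())).measurable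
    have hup : Measurable fun q : Cube d × unitInterval => Function.update q.1 i q.2 :=
      measurable_update'
    have hhm : Measurable h :=
      Measurable.lintegral_prod_right' (f := fun q : Cube d × unitInterval =>
        g (Function.update q.1 i q.2) *
          ENNReal.ofReal (condDensity p i (Function.update q.1 i q.2)))
        ((hg.comp hup).mul ((hcd.comp hup).ennreal_ofReal))
    have hhi : ∀ y y' : Cube d, (∀ j : Fin d, (j : ℕ) < n → y j = y' j) → h y = h y' := by
      intro y y' hyy
      simp only [hh]
      refine lintegral_congr fun s => ?_
      rw [condDensity_update_congr p i (fun j hj => hyy j hj)]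
      congr 1
      refine hgi _ _ fun j hj => ?_
      rcases eq_or_ne j i with rfl | hne
      · simp
      · have : (j : ℕ) ≠ n := fun e => hne (Fin.ext e)
        simpa [hne] using hyy j (by omega)
    have hstep : ∀ u : Fin d → ℝ, ∫⁻ r in Ico (0 : ℝ) 1, g (rosenblattInv p (Function.update u i r))
        = h (rosenblattInv p u) := by
      intro u
      obtain ⟨hQm, hQ⟩ := map_quantile
        (continuous_condDensity_update hp hc hpc i (rosenblattInv p u))
        (fun _ => condDensity_nonneg hp hc hpc _ _)
        (integral_condDensity_update hp hc hpc i (rosenblattInv p u))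
      have hlow : ∀ r, ∀ j, j < i →
          rosenblattInv p (Function.update u i r) j = rosenblattInv p u j := fun r j hj =>
        rosenblattInv_congr p j fun l hl => Function.update_of_ne (hl.trans_lt hj).ne _ _
      have hval : ∀ r : ℝ, g (rosenblattInv p (Function.update u i r)) =
          g (Function.update (rosenblattInv p u) i (sInf {s : unitInterval | r ≤
            ∫ r' in Iic s, condDensity p i (Function.update (rosenblattInv p u) i r')})) := by
        intro r
        refine hgi _ _ fun j hj => ?_
        rcases eq_or_ne j i with rfl | hne
        · rw [rosenblattInv_eq, rosenblattCDF_congr p _ (hlow r)]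
          simp [rosenblattCDF]
        · have : (j : ℕ) ≠ n := fun e => hne (Fin.ext e)
          rw [Function.update_of_ne hne]
          exact hlow r j (Fin.lt_def.2 (by simp [hidef]; omega))
      simp only [hval]
      have hgu : Measurable fun s : unitInterval =>
          g (Function.update (rosenblattInv p u) i s) := hg.comp (measurable_update _)
      rw [← lintegral_map (μ := volume.restrict (Ico (0 : ℝ) 1))
        (f := fun s : unitInterval => g (Function.update (rosenblattInv p u) i s)) hgu hQm, hQ,
        lintegral_withDensity_eq_lintegral_mul _ _ hgu]
      · simp only [hh, Pi.mul_apply, mul_comm]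
      · exact (continuous_condDensity_update hp hc hpc i _).measurable.ennreal_ofReal
    have hM : ∀ l, Measurable (marginalDensity p l) := fun l =>
      (continuous_marginalDensity_single hp l).measurable
    calc ∫⁻ u, g (rosenblattInv p u) ∂uniformMeasure d
        = ∫⁻ u, h (rosenblattInv p u) ∂uniformMeasure d := by
          refine (lintegral_update (fun _ : Fin d => volume.restrict (Ico (0 : ℝ) 1)) i
            (hg.comp hX)).symm.trans ?_
          exact lintegral_congr hstep
      _ = ∫⁻ y, h y * ENNReal.ofReal (marginalDensity p n y) :=
          ih (by omega) h hhm hhi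
      _ = ∫⁻ y : Cube d, ∫⁻ s : unitInterval, g (Function.update y i s) *
            ENNReal.ofReal (marginalDensity p (n + 1) (Function.update y i s)) := by
          refine lintegral_congr fun y => ?_
          rw [hh, ← lintegral_mul_const']
          · refine lintegral_congr fun s => ?_
            rw [mul_assoc, ← ENNReal.ofReal_mul (condDensity_nonneg hp hc hpc _ _),
              condDensity_update_eq]
            rw [div_mul_cancel₀ _ (marginalDensity_pos hp hc hpc _ _).ne']
          · exact ENNReal.ofReal_ne_top
      _ = _ := lintegral_update (fun _ : Fin d => (volume : Measure unitInterval)) i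
            (g := fun y => g y * ENNReal.ofReal (marginalDensity p (n + 1) y))
            (hg.mul (hM _).ennreal_ofReal)

/-- The inverse Rosenblatt transformation maps the uniform distribution on `[0,1)^d` to the
distribution with density `p`. -/
theorem map_rosenblattInv (hp : Continuous p) {c : ℝ} (hc : 0 < c)
    (hpc : ∀ y, c ≤ p y) (h1 : ∫ y, p y = 1) {A : Set (Cube d)} (hA : MeasurableSet A) :
    uniformMeasure d (rosenblattInv p ⁻¹' A) = ∫⁻ y in A, ENNReal.ofReal (p y) := by
  have hX := measurable_rosenblattInv_single hp hc hpc
  have hmd : ∀ y, marginalDensity p d y = p y := fun y => by simp [marginalDensity]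
  have := lintegral_rosenblattInv_of_dependsOn hp hc hpc h1 d le_rfl (A.indicator 1)
    (measurable_one.indicator hA) (fun y y' h => by rw [funext fun j => h j j.2])
  rw [← lintegral_indicator_one (hX hA), ← lintegral_indicator hA]
  refine Eq.trans ?_ (this.trans ?_)
  · rfl
  · refine lintegral_congr fun y => ?_
    by_cases hy : y ∈ A <;> simp [hy, hmd]

end Density

/-! ### Digits of nets and sequences -/

lemma exists_sum_digits_eq {b : ℕ} (R : ℕ) (δ : ℕ → Fin b) :
    ∃ c < b ^ R,
      ∑ k ∈ Finset.range R, ((δ k : ℕ) : ℝ) / (b : ℝ) ^ (k + 1) = (c : ℝ) / (b : ℝ) ^ R := by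
  have hb0 : (b : ℝ) ≠ 0 := by exact_mod_cast (Fin.pos (δ 0)).ne'
  induction R with
  | zero => exact ⟨0, by simp, by simp⟩
  | succ R ih =>
    obtain ⟨c, hc, h⟩ := ih
    refine ⟨c * b + δ R, ?_, ?_⟩
    · have h1 : (c + 1) * b ≤ b ^ R * b := Nat.mul_le_mul_right b hc
      have h2 := (δ R).2
      rw [pow_succ]
      nlinarith
    · rw [Finset.sum_range_succ, h, pow_succ]
      push_cast
      field_simp

/-- If a `b`-adic expansion represents a point in the second of the `b` equal parts of
`[c b^{-R}, (c + 1) b^{-R})`, then its truncation to `R` digits is `c b^{-R}`. -/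
lemma sum_digits_eq {b : ℕ} (hb : 2 ≤ b) (R : ℕ) (δ : ℕ → Fin b) {c : ℕ}
    (h1 : ((c * b + 1 : ℕ) : ℝ) / (b : ℝ) ^ (R + 1) ≤
      ∑' k : ℕ, ((δ k : ℕ) : ℝ) / (b : ℝ) ^ (k + 1))
    (h2 : ∑' k : ℕ, ((δ k : ℕ) : ℝ) / (b : ℝ) ^ (k + 1) <
      (((c * b + 1 : ℕ) : ℝ) + 1) / (b : ℝ) ^ (R + 1)) :
    ∑ k ∈ Finset.range R, ((δ k : ℕ) : ℝ) / (b : ℝ) ^ (k + 1) = (c : ℝ) / (b : ℝ) ^ R := by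
  have hb0 : (0 : ℝ) < b := by positivity
  have hb2 : (2 : ℝ) ≤ b := by exact_mod_cast hb
  have hsplit := Real.ofDigits_eq_sum_add_ofDigits δ R
  simp only [Real.ofDigits, Real.ofDigitsTerm, ← div_eq_mul_inv] at hsplit
  have ht0 := Real.ofDigits_nonneg (fun i => δ (i + R))
  have ht1 := Real.ofDigits_le_one (fun i => δ (i + R))
  simp only [Real.ofDigits, Real.ofDigitsTerm, ← div_eq_mul_inv] at ht0 ht1
  rw [hsplit] at h1 h2
  set τ := ∑' n, ((δ (n + R) : ℕ) : ℝ) / (b : ℝ) ^ (n + 1)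
  obtain ⟨N, -, hN⟩ := exists_sum_digits_eq R δ
  rw [hN] at h1 h2 ⊢
  have hpR : (0 : ℝ) < (b : ℝ) ^ R := by positivity
  have e1 : (N : ℝ) / (b : ℝ) ^ R + ((b : ℝ) ^ R)⁻¹ * τ = ((N + τ) * b) / (b : ℝ) ^ (R + 1) := by
    rw [pow_succ]
    field_simp
  rw [e1, div_le_div_iff_of_pos_right (by positivity)] at h1
  rw [e1, div_lt_div_iff_of_pos_right (by positivity)] at h2
  push_cast at h1 h2
  have hle : N < c + 1 := by
    have : (N : ℝ) < c + 1 := by nlinarith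
    exact_mod_cast this
  have hge : c < N + 1 := by
    have : (c : ℝ) < N + 1 := by nlinarith
    exact_mod_cast this
  rw [show N = c by omega]

/-- In every block of length `b ^ (t + s (R + 1))`, every combination of the first `R` digits of the
coordinates occurs. A refinement by one more digit avoids the points with two expansions. -/
lemma IsTSSequence.exists_digits {b t s : ℕ} (hb : 2 ≤ b) (R : ℕ) {a : ℕ → Fin s → ℕ → Fin b}
    (ha : IsTSSequence b t
      (fun n i => ∑' k : ℕ, ((a n i k : ℕ) : ℝ) / (b : ℝ) ^ (k + 1)))
    (j : ℕ) (c : Fin s → ℕ) (hc : ∀ i, c i < b ^ R) :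
    ∃ n < b ^ (t + s * (R + 1)), ∀ i,
      ∑ k ∈ Finset.range R, ((a (j * b ^ (t + s * (R + 1)) + n) i k : ℕ) : ℝ) / (b : ℝ) ^ (k + 1) =
        (c i : ℝ) / (b : ℝ) ^ R := by
  have hb0 : (b : ℝ) ≠ 0 := by positivity
  obtain ⟨-, hbox⟩ := ha j (t + s * (R + 1)) (Nat.le_add_right _ _)
  have hcard := hbox (fun i => c i * b + 1) (fun _ => R + 1)
    (fun i => by
      have h : (c i + 1) * b ≤ b ^ R * b := Nat.mul_le_mul_right b (hc i)
      rw [pow_succ]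
      nlinarith)
    (by
      rw [Finset.prod_const, Finset.card_univ, Fintype.card_fin]
      have : ((t : ℤ) - ((t + s * (R + 1) : ℕ) : ℤ)) = -(((R + 1) * s : ℕ) : ℤ) := by
        push_cast; ring
      rw [this, zpow_neg, zpow_natCast, pow_mul, inv_pow])
  obtain ⟨n, hn⟩ := nonempty_of_ncard_ne_zero (hcard.trans_ne (by positivity))
  exact ⟨n, n.2, fun i => sum_digits_eq hb R _ (hn i).1 (hn i).2⟩

/-- The first point of the sequence being `0`, the net property keeps the next ones away from
`0`. -/
lemma IsTSSequence.lower_bound {b : ℕ} (hb : 2 ≤ b) {v : ℕ → ℝ}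
    (hv : IsTSSequence b 0 (fun n (_ : Fin 1) => v n)) (hv0 : v 0 = 0) {n : ℕ} (hn : n ≠ 0) :
    ((b : ℝ) * n)⁻¹ ≤ v n ∧ v n < 1 := by
  have hb0 : (b : ℝ) ≠ 0 := by positivity
  set m := Nat.log b n + 1 with hm
  obtain ⟨hI, hbox⟩ := hv 0 m (Nat.zero_le _)
  have hnm : n < b ^ m := Nat.lt_pow_succ_log_self (by omega) n
  have hmn : b ^ m ≤ b * n := by
    rw [hm, pow_succ, mul_comm]
    exact Nat.mul_le_mul_left b (Nat.pow_log_le_self b hn)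
  have hcard := hbox (fun _ => 0) (fun _ => m) (fun _ => by positivity) (by simp)
  rw [pow_zero, ncard_eq_one] at hcard
  obtain ⟨q, hq⟩ := hcard
  have hvn := hI ⟨n, hnm⟩ 0
  simp only [zero_mul, zero_add] at hvn
  refine ⟨?_, hvn.2⟩
  by_contra hlt
  rw [not_le] at hlt
  have hpos : (0 : ℝ) < (b : ℝ) ^ m := by positivity
  have hsmall : v n < 1 / (b : ℝ) ^ m := by
    refine hlt.trans_le ?_
    rw [one_div]
    refine inv_anti₀ hpos ?_
    exact_mod_cast hmn
  have m1 : (⟨n, hnm⟩ : Fin (b ^ m)) ∈ ({q} : Set _) := by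
    rw [← hq]
    intro j
    simpa using ⟨hvn.1, by simpa using hsmall⟩
  have m2 : (⟨0, by positivity⟩ : Fin (b ^ m)) ∈ ({q} : Set _) := by
    rw [← hq]
    intro j
    simp only [zero_mul, zero_add, hv0]
    simpa using hpos
  have := m1.trans m2.symm
  simp only [Fin.mk.injEq] at this
  exact hn this

/-! ### The uniform distribution conditionally on the leading digits -/

section Box

variable {d : ℕ}

lemma uniformMeasure_eq_restrict :
    uniformMeasure d = volume.restrict (univ.pi fun _ : Fin d => Ico (0 : ℝ) 1) := by
  rw [uniformMeasure, volume_pi, Measure.restrict_pi_pi]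

/-- The half-open subcube of `[0,1)^d` of side `1 / β` with index `c`. -/
def gridBox (β : ℕ) (c : Fin d → ℕ) : Set (Fin d → ℝ) :=
  {w | ∀ i, (c i : ℝ) ≤ β * w i ∧ β * w i < c i + 1}

lemma uniformMeasure_preimage_affine {β : ℕ} (hβ : 0 < β) (c : Fin d → ℕ)
    {D : Set (Fin d → ℝ)} (hD : MeasurableSet D) :
    uniformMeasure d {z | (fun i => (c i : ℝ) / β + z i / β) ∈ D} =
      (β : ENNReal) ^ d * volume (gridBox β c ∩ D) := by
  have hβ' : (0 : ℝ) < β := by exact_mod_cast hβ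
  have hm : Measurable fun z : Fin d → ℝ => (fun i => (c i : ℝ) / β + z i / β) := by fun_prop
  rw [uniformMeasure_eq_restrict, Measure.restrict_apply (s := univ.pi fun _ : Fin d => Ico (0 : ℝ) 1)
    (show MeasurableSet {z : Fin d → ℝ | (fun i => (c i : ℝ) / β + z i / β) ∈ D} from hm hD)]
  have : {z : Fin d → ℝ | (fun i => (c i : ℝ) / β + z i / β) ∈ D} ∩
      (univ.pi fun _ : Fin d => Ico (0 : ℝ) 1) =
      ((fun i => (c i : ℝ)) + ·) ⁻¹' ((((β : ℝ)⁻¹) • ·) ⁻¹' (gridBox β c ∩ D)) := by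
    ext z
    have e : (β : ℝ)⁻¹ • ((fun i => (c i : ℝ)) + z) = fun i => (c i : ℝ) / β + z i / β := by
      funext i
      simp only [Pi.smul_apply, Pi.add_apply, smul_eq_mul]
      field_simp
    simp only [mem_inter_iff, Set.mem_ofPred_eq, mem_preimage, e, Set.mem_pi, mem_univ, true_implies,
      gridBox, mem_Ico]
    rw [and_comm]
    refine and_congr_left fun _ => forall_congr' fun i => ?_
    have e2 : (β : ℝ) * ((c i : ℝ) / β + z i / β) = c i + z i := by field_simp
    rw [e2]
    constructor <;> rintro ⟨h1, h2⟩ <;> constructor <;> linarith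
  rw [this, measure_preimage_add, Measure.addHaar_preimage_smul _ (by positivity)]
  congr 1
  rw [Module.finrank_fin_fun, inv_pow, inv_inv, abs_of_pos (by positivity),
    ENNReal.ofReal_pow hβ'.le, ENNReal.ofReal_natCast]

lemma uniformMeasure_preimage_affine_le {β : ℕ} (hβ : 0 < β) {c : Fin d → ℕ}
    (hc : ∀ i, c i < β) {D : Set (Fin d → ℝ)} (hD : MeasurableSet D) :
    uniformMeasure d {z | (fun i => (c i : ℝ) / β + z i / β) ∈ D} ≤
      (β : ENNReal) ^ d * uniformMeasure d D := by
  have hβ' : (0 : ℝ) < β := by exact_mod_cast hβ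
  rw [uniformMeasure_preimage_affine hβ c hD, uniformMeasure_eq_restrict,
    Measure.restrict_apply hD]
  refine mul_le_mul_right (measure_mono ?_) _
  rintro w ⟨hw, hwD⟩
  refine ⟨hwD, fun i _ => ?_⟩
  obtain ⟨h1, h2⟩ := hw i
  have h3 : (c i : ℝ) + 1 ≤ β := by exact_mod_cast hc i
  have h4 : (0 : ℝ) ≤ c i := by positivity
  constructor
  · by_contra h; nlinarith
  · by_contra h; nlinarith

/-- Pigeonhole principle: some subcube meets `D` at least in proportion to the volume of `D`. -/
lemma exists_le_uniformMeasure_preimage_affine {β : ℕ} (hβ : 0 < β) {D : Set (Fin d → ℝ)}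
    (hD : MeasurableSet D) :
    ∃ c : Fin d → ℕ, (∀ i, c i < β) ∧
      uniformMeasure d D ≤
        uniformMeasure d {z | (fun i => (c i : ℝ) / β + z i / β) ∈ D} := by
  have hβ' : (0 : ℝ) < β := by exact_mod_cast hβ
  have : Nonempty (Fin β) := ⟨⟨0, hβ⟩⟩
  have hcover : uniformMeasure d D ≤
      ∑ c : Fin d → Fin β, volume (gridBox β (fun i => (c i : ℕ)) ∩ D) := by
    rw [uniformMeasure_eq_restrict, Measure.restrict_apply hD]
    refine (measure_mono fun w hw => ?_).trans (measure_iUnion_fintype_le _ _)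
    have hfl : ∀ i, ⌊(β : ℝ) * w i⌋₊ < β := fun i => by
      have := hw.2 i (mem_univ i)
      refine (Nat.floor_lt (mul_nonneg hβ'.le this.1)).2 ?_
      nlinarith [this.2]
    refine mem_iUnion.2 ⟨fun i => ⟨_, hfl i⟩, fun i => ?_, hw.1⟩
    have := hw.2 i (mem_univ i)
    exact ⟨Nat.floor_le (mul_nonneg hβ'.le this.1), Nat.lt_floor_add_one _⟩
  have hsum : ∑ _c : Fin d → Fin β, uniformMeasure d D ≤ ∑ c : Fin d → Fin β,
      uniformMeasure d {z | (fun i => ((c i : ℕ) : ℝ) / β + z i / β) ∈ D} := by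
    have e : ∀ c : Fin d → Fin β,
        uniformMeasure d {z | (fun i => ((c i : ℕ) : ℝ) / β + z i / β) ∈ D} =
          (β : ENNReal) ^ d * volume (gridBox β (fun i => (c i : ℕ)) ∩ D) := fun c =>
      uniformMeasure_preimage_affine hβ (fun i => (c i : ℕ)) hD
    simp only [e]
    rw [← Finset.mul_sum, Finset.sum_const, Finset.card_univ, Fintype.card_fun, Fintype.card_fin,
      Fintype.card_fin, nsmul_eq_mul]
    push_cast
    gcongr
  obtain ⟨c, -, hc⟩ := ENNReal.exists_le_of_sum_le Finset.univ_nonempty hsum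
  exact ⟨fun i => c i, fun i => (c i).2, hc⟩

end Box

/-! ### Level sets -/

section Level

variable {d : ℕ}

/-- A set with a finite Minkowski content is negligible. -/
lemma HasMinkowskiContent.volume_eq_zero {A : Set (Cube d)} {M : ℝ}
    (h : HasMinkowskiContent A M) : volume A = 0 := by
  have hlim : Tendsto (fun ε : ℝ => (volume (thickened A ε)).toReal) (𝓝[>] 0) (𝓝 0) := by
    have h0 : Tendsto (fun ε : ℝ => ε) (𝓝[>] 0) (𝓝 0) := tendsto_nhdsWithin_of_tendsto_nhds
      tendsto_id
    have := h0.mul h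
    rw [zero_mul] at this
    refine this.congr' ?_
    filter_upwards [self_mem_nhdsWithin] with ε hε
    have : ε ≠ 0 := ne_of_gt hε
    field_simp
  have hle : (volume A).toReal ≤ 0 := by
    refine ge_of_tendsto hlim ?_
    filter_upwards [self_mem_nhdsWithin] with ε hε
    exact ENNReal.toReal_mono (measure_ne_top _ _)
      (measure_mono fun x hx => ⟨x, hx, by rw [dist_self]; exact le_of_lt hε⟩)
  have := le_antisymm hle ENNReal.toReal_nonneg
  rcases (ENNReal.toReal_eq_zero_iff _).1 this with h | h
  · exact h
  · exact absurd h (measure_ne_top _ _)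

/-- If a level set is negligible, then the set of points at nearby levels is small. -/
lemma exists_volume_preimage_Ioo_le {φ : Cube d → ℝ} (hφ : Continuous φ) {a : ℝ}
    (h0 : volume {x | φ x = a} = 0) {ε : ENNReal} (hε : 0 < ε) :
    ∃ η > 0, volume (φ ⁻¹' Ioo (a - η) (a + η)) ≤ ε := by
  have hlim := tendsto_measure_iInter_atTop (μ := volume)
    (s := fun n : ℕ => φ ⁻¹' Ioo (a - 1 / ((n : ℝ) + 1)) (a + 1 / ((n : ℝ) + 1)))
    (fun n => (hφ.measurable measurableSet_Ioo).nullMeasurableSet)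
    (fun m n hmn => preimage_mono (Ioo_subset_Ioo
      (sub_le_sub_left (Nat.one_div_le_one_div hmn) _)
      (add_le_add_right (Nat.one_div_le_one_div hmn) _))) ⟨0, measure_ne_top _ _⟩
  have hset : ⋂ n : ℕ, φ ⁻¹' Ioo (a - 1 / ((n : ℝ) + 1)) (a + 1 / ((n : ℝ) + 1)) ⊆
      {x | φ x = a} := by
    intro x hx
    rw [mem_iInter] at hx
    have hl : Tendsto (fun n : ℕ => 1 / ((n : ℝ) + 1)) atTop (𝓝 0) :=
      tendsto_one_div_add_atTop_nhds_zero_nat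
    refine le_antisymm ?_ ?_
    · have := (tendsto_const_nhds (x := a)).add hl
      rw [add_zero] at this
      exact ge_of_tendsto' this fun n => (hx n).2.le
    · have := (tendsto_const_nhds (x := a)).sub hl
      rw [sub_zero] at this
      exact le_of_tendsto' this fun n => (hx n).1.le
  rw [measure_mono_null hset h0] at hlim
  obtain ⟨n, hn⟩ := ((tendsto_order.1 hlim).2 ε hε).exists
  exact ⟨1 / ((n : ℝ) + 1), Nat.one_div_pos_of_nat, hn.le⟩

lemma volume_level_eq_zero {φ : Cube d → ℝ} {C : ℝ}
    (hM : ∀ x : Cube d, φ x < (⨆ x', φ x') →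
      ∃ M : ℝ, HasMinkowskiContent {x' | φ x' = φ x} M ∧ M ≤ C)
    {a : ℝ} (ha : a < ⨆ x', φ x') : volume {x | φ x = a} = 0 := by
  rcases eq_empty_or_nonempty {x | φ x = a} with h | ⟨x, rfl⟩
  · rw [h, measure_empty]
  · obtain ⟨M, hM, -⟩ := hM x ha
    exact hM.volume_eq_zero

instance : (volume : Measure unitInterval).IsOpenPosMeasure where
  open_pos U hU hne := by
    obtain ⟨x, hx⟩ := hne
    rcases eq_or_ne x 1 with rfl | hx1
    · obtain ⟨l, hl, hlU⟩ := exists_Ioc_subset_of_mem_nhds (hU.mem_nhds hx) ⟨0, zero_lt_one⟩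
      refine (lt_of_lt_of_le ?_ (measure_mono hlU)).ne'
      rw [unitInterval.volume_Ioc, ENNReal.ofReal_pos, sub_pos]
      exact hl
    · have hlt : x < 1 := lt_of_le_of_ne le_top hx1
      obtain ⟨r, hr, hrU⟩ := exists_Ico_subset_of_mem_nhds (hU.mem_nhds hx) ⟨1, hlt⟩
      refine (lt_of_lt_of_le ?_ (measure_mono hrU)).ne'
      rw [unitInterval.volume_Ico, ENNReal.ofReal_pos, sub_pos]
      exact hr

/-- The set of points with values above a given level is not negligible. -/
lemma volume_superlevel_pos {φ : Cube d → ℝ} (hφ : Continuous φ) {a : ℝ}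
    (ha : a < ⨆ x', φ x') : 0 < volume {x | a < φ x} := by
  obtain ⟨x, hx⟩ := exists_lt_of_lt_ciSup ha
  exact (isOpen_lt continuous_const hφ).measure_pos _ ⟨x, hx⟩

end Level

/-! ### Convergence of the values along a trajectory -/

section Run

variable {d : ℕ} {φ : Cube d → ℝ} {k : Cube d → Cube d → ℝ} {x₀ : Cube d} {u : ℕ → Fin d → ℝ}
  {v : ℕ → ℝ} {T : ℕ → ℝ} {x : ℕ → Cube d}

lemma IsRun.eq_or_eq (h : IsRun φ k x₀ u v T x) (n : ℕ) :
    x (n + 1) = rosenblattInv (k (x n)) (u (n + 1)) ∨ x (n + 1) = x n :=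
  (le_or_gt _ _).imp (h.accept n) (h.reject n)

lemma IsRun.eq_of_le (h : IsRun φ k x₀ u v T x) {n : ℕ} (hv : v (n + 1) < 1)
    (hle : φ (x n) ≤ φ (rosenblattInv (k (x n)) (u (n + 1)))) :
    x (n + 1) = rosenblattInv (k (x n)) (u (n + 1)) := by
  refine h.accept n (hv.le.trans (Real.one_le_exp ?_))
  exact div_nonneg (sub_nonneg.2 hle) (h.temp_pos _ (by omega)).le

/-- An accepted move decreases `φ` by at most `T_n log (b n)`, as `v_n ≥ 1 / (b n)`. -/
lemma IsRun.sub_le (h : IsRun φ k x₀ u v T x) {b : ℕ} (hb : 2 ≤ b) {n : ℕ}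
    (hv : ((b : ℝ) * (n + 1 : ℕ))⁻¹ ≤ v (n + 1)) :
    φ (x n) - T (n + 1) * (Real.log b + Real.log (n + 1 : ℕ)) ≤ φ (x (n + 1)) := by
  have hT := h.temp_pos (n + 1) (by omega)
  have hb0 : (0 : ℝ) < b := by positivity
  have hn0 : (0 : ℝ) < (n + 1 : ℕ) := by positivity
  have hb1 : 0 ≤ Real.log b := Real.log_natCast_nonneg _
  have hn1 : 0 ≤ Real.log (n + 1 : ℕ) := Real.log_natCast_nonneg _
  rcases le_or_gt (v (n + 1))
    (Real.exp ((φ (rosenblattInv (k (x n)) (u (n + 1))) - φ (x n)) / T (n + 1))) with hacc | hrej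
  · have hx := h.accept n hacc
    rw [← hx] at hacc
    have hlog := (Real.log_le_iff_le_exp (by positivity)).2 (hv.trans hacc)
    rw [Real.log_inv, Real.log_mul hb0.ne' hn0.ne', le_div_iff₀ hT] at hlog
    nlinarith
  · rw [h.reject n hrej]
    have := mul_nonneg hT.le (add_nonneg hb1 hn1)
    linarith

/-- The total decrease of `φ` along the trajectory being finite, its values converge. -/
lemma IsRun.exists_tendsto (h : IsRun φ k x₀ u v T x) {b : ℕ} (hb : 2 ≤ b)
    (hv : ∀ n : ℕ, n ≠ 0 → ((b : ℝ) * n)⁻¹ ≤ v n)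
    (hT : Summable fun n : ℕ => T n * Real.log n) {B : ℝ} (hB : ∀ y, φ y ≤ B) :
    ∃ a, Tendsto (fun n => φ (x n)) atTop (𝓝 a) := by
  have hTs : Summable T := by
    refine Summable.of_norm_bounded_eventually_nat (hT.mul_right (Real.log 2)⁻¹) ?_
    filter_upwards [eventually_ge_atTop 2] with n hn
    have hpos := h.temp_pos n (by omega)
    have hlog : Real.log 2 ≤ Real.log n := Real.log_le_log two_pos (by exact_mod_cast hn)
    rw [Real.norm_of_nonneg hpos.le, ← div_eq_mul_inv, le_div_iff₀ (Real.log_pos one_lt_two)]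
    gcongr
  set D : ℕ → ℝ := fun n => T (n + 1) * (Real.log b + Real.log (n + 1 : ℕ)) with hD
  have hDs : Summable D := by
    refine (((summable_nat_add_iff 1).2 (hTs.mul_right (Real.log b))).add
      ((summable_nat_add_iff 1).2 hT)).congr fun n => ?_
    simp only [hD]
    ring
  have hD0 : ∀ n, 0 ≤ D n := fun n => mul_nonneg (h.temp_pos _ (by omega)).le
    (add_nonneg (Real.log_natCast_nonneg _) (Real.log_natCast_nonneg _))
  have hmono : Monotone fun n => φ (x n) + ∑ i ∈ Finset.range n, D i := by
    refine monotone_nat_of_le_succ fun n => ?_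
    rw [Finset.sum_range_succ]
    have := h.sub_le hb (hv (n + 1) (by omega))
    simp only [hD] at *
    linarith
  have hbdd : BddAbove (range fun n => φ (x n) + ∑ i ∈ Finset.range n, D i) := by
    refine ⟨B + ∑' i, D i, ?_⟩
    rintro _ ⟨n, rfl⟩
    exact add_le_add (hB _) (hDs.sum_le_tsum _ fun i _ => hD0 i)
  refine ⟨_, ((tendsto_atTop_ciSup hmono hbdd).sub hDs.hasSum.tendsto_sum_nat).congr fun n => ?_⟩
  ring

/-- If the values of the trajectory stay in a window during a block of `L` steps, then either some
proposal made from the initial point of the block is in the window, or none of these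
proposals is above the level `h`: otherwise the trajectory would not move until it accepts a
proposal above the window. -/
lemma IsRun.block (hr : IsRun φ k x₀ u v T x) (hv : ∀ n, n ≠ 0 → v n < 1) {W : Set ℝ} {h : ℝ}
    (hW : ∀ w ∈ W, w ≤ h) {M L : ℕ} (hstay : ∀ n, M ≤ n → n ≤ M + L → φ (x n) ∈ W) :
    (∃ m < L, φ (rosenblattInv (k (x M)) (u (M + 1 + m))) ∈ W) ∨
      ∀ m < L, φ (rosenblattInv (k (x M)) (u (M + 1 + m))) ≤ h := by
  by_contra! hcon
  obtain ⟨hout, m, hm, hgt⟩ := hcon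
  have hconst : ∀ m ≤ L, x (M + m) = x M := by
    intro m hm
    induction m with
    | zero => rfl
    | succ m ih =>
      have ih := ih (by omega)
      rcases hr.eq_or_eq (M + m) with he | he
      · have hin := hstay (M + m + 1) (by omega) (by omega)
        rw [he, ih, show M + m + 1 = M + 1 + m by omega] at hin
        exact absurd hin (hout m (by omega))
      · rw [show M + (m + 1) = M + m + 1 by omega, he, ih]
  have hx := hconst m hm.le
  have hMW := hW _ (hstay M le_rfl (by omega))
  have hacc := hr.eq_of_le (n := M + m) (hv _ (by omega))
    (by rw [hx, show M + m + 1 = M + 1 + m by omega]; linarith)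
  have hin := hW _ (hstay (M + m + 1) (by omega) (by omega))
  rw [hacc, hx, show M + m + 1 = M + 1 + m by omega] at hin
  linarith

end Run

/-! ### Independence of the past and the future -/

section Independence

/-- If `Z` is independent of the past, then a bound on the probability of `(x, Z) ∈ A` that is
uniform in `x` holds conditionally on the past for a point `X` determined by the past. -/
lemma measure_inter_preimage_le {Ω E F : Type*} {m m0 : MeasurableSpace Ω} {P : Measure[m0] Ω}
    [IsProbabilityMeasure P] [MeasurableSpace E] [MeasurableSpace F] (hm : m ≤ m0)
    {Z : Ω → E} (hZ : Measurable[m0] Z) (hind : Indep m (MeasurableSpace.comap Z inferInstance) P)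
    {X : Ω → F} (hX : Measurable[m] X) {S : Set Ω} (hS : MeasurableSet[m] S)
    {A : Set (F × E)} (hA : MeasurableSet A) {c : ENNReal}
    (hc : ∀ x, P {ω | (x, Z ω) ∈ A} ≤ c) :
    P (S ∩ {ω | (X ω, Z ω) ∈ A}) ≤ c * P S := by
  set Y : Ω → Prop × F := fun ω => (ω ∈ S, X ω) with hY
  have hYm : Measurable[m] Y := Measurable.prodMk ((@measurableSet_setOfPred Ω m fun ω => ω ∈ S).1 hS) hX
  have hYm0 : Measurable[m0] Y := hYm.mono hm le_rfl
  have hYZ : IndepFun Y Z P := indep_of_indep_of_le_left hind hYm.comap_le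
  have hlaw := (indepFun_iff_map_prod_eq_prod_map_map hYm0.aemeasurable hZ.aemeasurable).1 hYZ
  set Q : Set ((Prop × F) × E) := {w | w.1.1} ∩ {w | (w.1.2, w.2) ∈ A} with hQ
  have hp : MeasurableSet {y : Prop × F | y.1} := measurableSet_setOfPred.2 measurable_fst
  have hQm : MeasurableSet Q := by
    refine (measurableSet_setOfPred.2 (measurable_fst.comp measurable_fst)).inter ?_
    exact ((measurable_snd.comp measurable_fst).prodMk measurable_snd) hA
  have hpre : S ∩ {ω | (X ω, Z ω) ∈ A} = (fun ω => (Y ω, Z ω)) ⁻¹' Q := rfl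
  rw [hpre, ← Measure.map_apply (hYm0.prodMk hZ) hQm, hlaw, Measure.prod_apply hQm]
  calc ∫⁻ y, (P.map Z) (Prod.mk y ⁻¹' Q) ∂(P.map Y)
      ≤ ∫⁻ y, {y : Prop × F | y.1}.indicator (fun _ => c) y ∂(P.map Y) := by
        refine lintegral_mono fun y => ?_
        by_cases hy : y.1
        · rw [indicator_of_mem (show y ∈ {y : Prop × F | y.1} from hy),
            Measure.map_apply hZ (measurable_prodMk_left hQm)]
          exact (measure_mono fun ω hω => hω.2).trans (hc y.2)
        · have : Prod.mk y ⁻¹' Q = ∅ := by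
            ext e
            simp [hQ, hy]
          simp [this]
    _ = c * P S := by
        rw [lintegral_indicator_const hp, Measure.map_apply hYm0 hp]
        rfl

variable {Ω : Type*} {d : ℕ} {z : ℕ × Fin d → Ω → ℝ}

/-- The information carried by the variables `z` with time index less than `n`. -/
abbrev pastSigma (z : ℕ × Fin d → Ω → ℝ) (n : ℕ) : MeasurableSpace Ω :=
  ⨆ q ∈ {q : ℕ × Fin d | q.1 < n}, MeasurableSpace.comap (z q) inferInstance

lemma pastSigma_mono : Monotone (pastSigma z) := fun _ _ h =>
  biSup_mono fun _ hq => lt_of_lt_of_le hq h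

lemma measurable_pastSigma {n : ℕ} {q : ℕ × Fin d} (hq : q.1 < n) :
    Measurable[pastSigma z n] (z q) :=
  (comap_measurable (z q)).mono
    (le_iSup₂_of_le (f := fun q (_ : q ∈ {q : ℕ × Fin d | q.1 < n}) =>
      MeasurableSpace.comap (z q) inferInstance) q hq le_rfl) le_rfl

variable [MeasurableSpace Ω] {P : Measure Ω}

lemma pastSigma_le (hz : ∀ q, Measurable (z q)) (n : ℕ) :
    pastSigma z n ≤ (inferInstance : MeasurableSpace Ω) :=
  iSup₂_le fun q _ => (hz q).comap_le

/-- The variables with time index at least `n` are independent of the past before `n`. -/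
lemma indep_pastSigma (hz : ∀ q, Measurable (z q)) (hind : iIndepFun z P) (n : ℕ)
    {E : Type*} [MeasurableSpace E] {Z : Ω → E}
    (hZ : Measurable[⨆ q ∈ {q : ℕ × Fin d | n ≤ q.1},
      MeasurableSpace.comap (z q) inferInstance] Z) :
    Indep (pastSigma z n) (MeasurableSpace.comap Z inferInstance) P := by
  refine indep_of_indep_of_le_right (indep_iSup_of_disjoint (fun q => (hz q).comap_le) hind ?_)
    hZ.comap_le
  rw [Set.disjoint_left]
  intro q hq hq'
  exact absurd (show q.1 < n from hq) (not_lt.2 hq')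

lemma map_coordinates_eq [IsProbabilityMeasure P] (hz : ∀ q, Measurable (z q))
    (hunif : ∀ q, pdf.IsUniform (z q) (Ico (0 : ℝ) 1) P volume)
    (hind : iIndepFun z P) (n : ℕ) :
    P.map (fun ω i => z (n, i) ω) = uniformMeasure d := by
  have h1 : iIndepFun (fun i : Fin d => z (n, i)) P :=
    hind.precomp (g := fun i : Fin d => (n, i)) fun i j h => (Prod.mk.inj h).2
  rw [h1.map_fun_eq_pi_map fun i => (hz _).aemeasurable]
  congr 1
  funext i
  have : P.map (z (n, i)) = ProbabilityTheory.cond volume (Ico (0 : ℝ) 1) := hunif (n, i)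
  rw [this, ProbabilityTheory.cond]
  simp

lemma measure_affine_mem [IsProbabilityMeasure P] (hz : ∀ q, Measurable (z q))
    (hunif : ∀ q, pdf.IsUniform (z q) (Ico (0 : ℝ) 1) P volume)
    (hind : iIndepFun z P) (n : ℕ) (c : Fin d → ℕ) (β : ℕ) {D : Set (Fin d → ℝ)}
    (hD : MeasurableSet D) :
    P {ω | (fun i => (c i : ℝ) / β + z (n, i) ω / β) ∈ D} =
      uniformMeasure d {w | (fun i => (c i : ℝ) / β + w i / β) ∈ D} := by
  have hm : Measurable fun w : Fin d → ℝ => (fun i => (c i : ℝ) / β + w i / β) := by fun_prop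
  rw [← map_coordinates_eq hz hunif hind n,
    Measure.map_apply (measurable_pi_lambda _ fun i => hz (n, i)) (show MeasurableSet
      {w : Fin d → ℝ | (fun i => (c i : ℝ) / β + w i / β) ∈ D} from hm hD)]
  rfl

end Independence

/-! ### The trajectory leaves every window of levels below the maximum -/

lemma measurable_run {d : ℕ} {φ : Cube d → ℝ} (hφ : Continuous φ) {k : Cube d → Cube d → ℝ}
    (hk : Continuous fun q : Cube d × Cube d => k q.1 q.2) {κ : ℝ} (hκ : 0 < κ)
    (hkκ : ∀ x y, κ ≤ k x y) {Ω : Type*} {z : ℕ × Fin d → Ω → ℝ}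
    {u : ℕ → Ω → Fin d → ℝ} (hu : ∀ n, Measurable[pastSigma z (n + 1)] (u n)) {v : ℕ → ℝ}
    {x₀ : Cube d} {T : ℕ → Ω → ℝ} {x : ℕ → Ω → Cube d}
    (hx : ∀ ω, IsRun φ k x₀ (fun n => u n ω) v (fun n => T n ω) (fun n => x n ω))
    (hT : ∀ n : ℕ,
      Measurable[⨆ i : Fin (n + 1), MeasurableSpace.comap (x i) inferInstance] (T (n + 1)))
    (n : ℕ) : Measurable[pastSigma z (n + 1)] (x n) := by
  induction n using Nat.strong_induction_on with
  | _ n ih =>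
    cases n with
    | zero =>
      have : x 0 = fun _ => x₀ := funext fun ω => (hx ω).start
      rw [this]
      exact measurable_const
    | succ n =>
      have hxn : Measurable[pastSigma z (n + 1 + 1)] (x n) :=
        (ih n (Nat.lt_succ_self n)).mono (pastSigma_mono (Nat.le_succ _)) le_rfl
      have hTn : Measurable[pastSigma z (n + 1 + 1)] (T (n + 1)) :=
        (hT n).mono (iSup_le fun i => (ih i i.2).comap_le.trans
          (pastSigma_mono (by have := i.2; omega))) le_rfl
      have hY : Measurable[pastSigma z (n + 1 + 1)]
          (fun ω => rosenblattInv (k (x n ω)) (u (n + 1) ω)) :=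
        (measurable_rosenblattInv hk hκ hkκ).comp (hxn.prodMk (hu (n + 1)))
      have hE : Measurable[pastSigma z (n + 1 + 1)] (fun ω => Real.exp
          ((φ (rosenblattInv (k (x n ω)) (u (n + 1) ω)) - φ (x n ω)) / T (n + 1) ω)) :=
        Real.measurable_exp.comp
          (((hφ.measurable.comp hY).sub (hφ.measurable.comp hxn)).div hTn)
      classical
      have heq : x (n + 1) = fun ω => if v (n + 1) ≤ Real.exp
          ((φ (rosenblattInv (k (x n ω)) (u (n + 1) ω)) - φ (x n ω)) / T (n + 1) ω) then
          rosenblattInv (k (x n ω)) (u (n + 1) ω) else x n ω := by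
        funext ω
        split_ifs with h
        · exact (hx ω).accept n h
        · exact (hx ω).reject n (not_le.1 h)
      rw [heq]
      exact Measurable.ite (measurableSet_le measurable_const hE) hY hxn

section Window

variable {d : ℕ} {φ : Cube d → ℝ} {k : Cube d → Cube d → ℝ} {κ : ℝ} {b t R : ℕ}
  {Ω : Type*} [MeasurableSpace Ω] {P : Measure Ω} [IsProbabilityMeasure P]
  {a : ℕ → Fin d → ℕ → Fin b} {z : ℕ × Fin d → Ω → ℝ} {u : ℕ → Ω → Fin d → ℝ}

/-- Whatever the first `R` digits of `u n`, the law of the proposal from `x` has a density bounded by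
`b ^ (R d)` times an upper bound of `k`. -/
lemma measure_proposal_mem_le (hb : 2 ≤ b)
    (hk : Continuous fun q : Cube d × Cube d => k q.1 q.2) (hκ : 0 < κ)
    (hkκ : ∀ x y, κ ≤ k x y) (hk1 : ∀ x, ∫ y, k x y = 1) {κ' : ℝ} (hkκ' : ∀ x y, k x y ≤ κ')
    (hz : ∀ q, Measurable (z q))
    (hunif : ∀ q, pdf.IsUniform (z q) (Ico (0 : ℝ) 1) P volume) (hind : iIndepFun z P)
    (hu : ∀ n ω i, u n ω i = (∑ j ∈ Finset.range R, ((a n i j : ℕ) : ℝ) / (b : ℝ) ^ (j + 1)) +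
      z (n, i) ω / (b : ℝ) ^ R)
    (n : ℕ) (x : Cube d) {A : Set (Cube d)} (hA : MeasurableSet A) :
    P {ω | rosenblattInv (k x) (u n ω) ∈ A} ≤
      ((b ^ R : ℕ) : ENNReal) ^ d * (ENNReal.ofReal κ' * volume A) := by
  have hp : Continuous (k x) := by fun_prop
  have hD := measurable_rosenblattInv_single hp hκ (hkκ x) hA
  choose c hc hce using fun i => exists_sum_digits_eq R (a n i)
  have hun : ∀ ω, u n ω = fun i => (c i : ℝ) / (b ^ R : ℕ) + z (n, i) ω / (b ^ R : ℕ) := by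
    intro ω
    funext i
    rw [hu, hce]
    push_cast
    rfl
  simp only [hun]
  refine (measure_affine_mem hz hunif hind n c (b ^ R) hD).trans_le
    ((uniformMeasure_preimage_affine_le (by positivity) hc hD).trans ?_)
  gcongr
  rw [map_rosenblattInv hp hκ (hkκ x) (hk1 x) hA]
  calc ∫⁻ y in A, ENNReal.ofReal (k x y) ≤ ∫⁻ _ in A, ENNReal.ofReal κ' :=
        lintegral_mono fun y => ENNReal.ofReal_le_ofReal (hkκ' x y)
    _ = _ := by simp

/-- In every block of length `b ^ (t + d (R + 1))`, some proposal from a fixed point `x` reaches the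
set `A` with a probability bounded below in terms of the volume of `A` only. -/
lemma exists_le_measure_proposal_mem (hb : 2 ≤ b)
    (hk : Continuous fun q : Cube d × Cube d => k q.1 q.2) (hκ : 0 < κ)
    (hkκ : ∀ x y, κ ≤ k x y) (hk1 : ∀ x, ∫ y, k x y = 1)
    (hz : ∀ q, Measurable (z q))
    (hunif : ∀ q, pdf.IsUniform (z q) (Ico (0 : ℝ) 1) P volume) (hind : iIndepFun z P)
    (ha : IsTSSequence b t
      (fun n i => ∑' j : ℕ, ((a n i j : ℕ) : ℝ) / (b : ℝ) ^ (j + 1)))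
    (hu : ∀ n ω i, u n ω i = (∑ j ∈ Finset.range R, ((a n i j : ℕ) : ℝ) / (b : ℝ) ^ (j + 1)) +
      z (n, i) ω / (b : ℝ) ^ R)
    (j : ℕ) (x : Cube d) {A : Set (Cube d)} (hA : MeasurableSet A) :
    ∃ m < b ^ (t + d * (R + 1)), ENNReal.ofReal κ * volume A ≤
      P {ω | rosenblattInv (k x) (u (j * b ^ (t + d * (R + 1)) + m) ω) ∈ A} := by
  have hp : Continuous (k x) := by fun_prop
  have hD := measurable_rosenblattInv_single hp hκ (hkκ x) hA
  obtain ⟨c, hc, hle⟩ :=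
    exists_le_uniformMeasure_preimage_affine (β := b ^ R) (by positivity) hD
  obtain ⟨m, hm, hdig⟩ := ha.exists_digits hb R j c hc
  refine ⟨m, hm, ?_⟩
  have hun : ∀ ω, u (j * b ^ (t + d * (R + 1)) + m) ω = fun i =>
      (c i : ℝ) / (b ^ R : ℕ) + z (j * b ^ (t + d * (R + 1)) + m, i) ω / (b ^ R : ℕ) := by
    intro ω
    funext i
    rw [hu, hdig]
    push_cast
    rfl
  simp only [hun]
  refine le_trans ?_ (hle.trans_eq (measure_affine_mem hz hunif hind _ c (b ^ R) hD).symm)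
  rw [map_rosenblattInv hp hκ (hkκ x) (hk1 x) hA]
  calc ENNReal.ofReal κ * volume A = ∫⁻ _ in A, ENNReal.ofReal κ := by simp
    _ ≤ _ := lintegral_mono fun y => ENNReal.ofReal_le_ofReal (hkκ x y)

/-- Around every level below the maximum there is a window of levels in which the trajectory almost
surely does not remain: a block of steps keeps it there with a conditional probability bounded
away from `1`. -/
lemma exists_window_null (hφ : Continuous φ) (hb : 2 ≤ b)
    (hk : Continuous fun q : Cube d × Cube d => k q.1 q.2) (hκ : 0 < κ)
    (hkκ : ∀ x y, κ ≤ k x y) (hk1 : ∀ x, ∫ y, k x y = 1)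
    (hz : ∀ q, Measurable (z q))
    (hunif : ∀ q, pdf.IsUniform (z q) (Ico (0 : ℝ) 1) P volume) (hind : iIndepFun z P)
    (ha : IsTSSequence b t
      (fun n i => ∑' j : ℕ, ((a n i j : ℕ) : ℝ) / (b : ℝ) ^ (j + 1)))
    (hu : ∀ n ω i, u n ω i = (∑ j ∈ Finset.range R, ((a n i j : ℕ) : ℝ) / (b : ℝ) ^ (j + 1)) +
      z (n, i) ω / (b : ℝ) ^ R)
    {v : ℕ → ℝ} (hv : ∀ n, n ≠ 0 → v n < 1)
    {x₀ : Cube d} {T : ℕ → Ω → ℝ} {x : ℕ → Ω → Cube d}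
    (hx : ∀ ω, IsRun φ k x₀ (fun n => u n ω) v (fun n => T n ω) (fun n => x n ω))
    (hT : ∀ n : ℕ,
      Measurable[⨆ i : Fin (n + 1), MeasurableSpace.comap (x i) inferInstance] (T (n + 1)))
    {l : ℝ} (hl : l < ⨆ y, φ y) (hl0 : volume {y | φ y = l} = 0) :
    ∃ η > 0, ∀ N, P {ω | ∀ n, N ≤ n → φ (x n ω) ∈ Ioo (l - η) (l + η)} = 0 := by
  obtain ⟨h, hlh, hh⟩ := exists_between hl
  set L := b ^ (t + d * (R + 1)) with hL
  have hL0 : 0 < L := by positivity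
  obtain ⟨κ', hκ'⟩ : ∃ κ' : ℝ, ∀ x y, k x y ≤ κ' := by
    obtain ⟨κ', hκ'⟩ := isCompact_univ.bddAbove_image hk.continuousOn
    exact ⟨κ', fun x y => hκ' (mem_image_of_mem _ (mem_univ (x, y)))⟩
  have hBm : MeasurableSet {y | h < φ y} := (isOpen_lt continuous_const hφ).measurableSet
  set p : ENNReal := ENNReal.ofReal κ * volume {y | h < φ y} with hp
  have hp0 : p ≠ 0 := mul_ne_zero (by simpa using hκ) (volume_superlevel_pos hφ hh).ne'
  have hp1 : p ≤ 1 := by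
    obtain ⟨m, -, hm⟩ :=
      exists_le_measure_proposal_mem hb hk hκ hkκ hk1 hz hunif hind ha hu 0 x₀ hBm
    exact hm.trans prob_le_one
  have hptop : p ≠ ⊤ := (hp1.trans_lt ENNReal.one_lt_top).ne
  set Γ : ENNReal := L * (((b ^ R : ℕ) : ENNReal) ^ d * ENNReal.ofReal κ') with hΓ
  have hΓtop : Γ ≠ ⊤ := ENNReal.mul_ne_top (ENNReal.natCast_ne_top _)
    (ENNReal.mul_ne_top (ENNReal.pow_ne_top (ENNReal.natCast_ne_top _)) ENNReal.ofReal_ne_top)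
  obtain ⟨η₀, hη₀, hvol⟩ := exists_volume_preimage_Ioo_le hφ hl0
    (ε := p / 2 / Γ) (ENNReal.div_pos (ENNReal.half_pos hp0).ne' hΓtop)
  -- The window is kept below the level `h`, so that every proposal above `h` is accepted.
  set η := min η₀ (h - l) with hη
  have hηpos : 0 < η := lt_min hη₀ (sub_pos.2 hlh)
  refine ⟨η, hηpos, fun N => ?_⟩
  set W := Ioo (l - η) (l + η) with hW
  have hWh : ∀ w ∈ W, w ≤ h := fun w hw => by
    have := min_le_right η₀ (h - l)
    linarith [hw.2]
  have hWm : MeasurableSet (φ ⁻¹' W) := hφ.measurable measurableSet_Ioo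
  have hWvol : Γ * volume (φ ⁻¹' W) ≤ p / 2 := by
    refine le_trans (mul_le_mul_right ?_ _) ENNReal.mul_div_le
    refine (measure_mono (preimage_mono (Ioo_subset_Ioo ?_ ?_))).trans hvol <;>
      linarith [min_le_left η₀ (h - l)]
  set c : ENNReal := p / 2 + (1 - p) with hc
  have hc1 : c < 1 := by
    calc c < p + (1 - p) := ENNReal.add_lt_add_right
          (ne_top_of_le_ne_top ENNReal.one_ne_top tsub_le_self) (ENNReal.half_lt_self hp0 hptop)
      _ = 1 := add_tsub_cancel_of_le hp1
  have hum : ∀ n, Measurable[pastSigma z (n + 1)] (u n) := by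
    intro n
    refine @measurable_pi_lambda _ _ _ (_) _ _ fun i => ?_
    simp only [hu]
    have haff : Measurable fun r : ℝ =>
        (∑ j ∈ Finset.range R, ((a n i j : ℕ) : ℝ) / (b : ℝ) ^ (j + 1)) + r / (b : ℝ) ^ R := by
      fun_prop
    exact haff.comp (measurable_pastSigma (q := (n, i)) (Nat.lt_succ_self n))
  have hum0 : ∀ n, Measurable (u n) := fun n => (hum n).mono (pastSigma_le hz _) le_rfl
  have hxm := measurable_run hφ hk hκ hkκ hum hx hT
  -- The bad set of pairs consisting of a current point and a future input sequence.
  set A : Set (Cube d × (ℕ → Fin d → ℝ)) :=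
    {q | (∃ m < L, φ (rosenblattInv (k q.1) (q.2 m)) ∈ W) ∨
      ∀ m < L, φ (rosenblattInv (k q.1) (q.2 m)) ≤ h} with hA
  have hAm : MeasurableSet A := by
    have hφY : ∀ m, Measurable fun q : Cube d × (ℕ → Fin d → ℝ) =>
        φ (rosenblattInv (k q.1) (q.2 m)) := fun m =>
      hφ.measurable.comp ((measurable_rosenblattInv hk hκ hkκ).comp
        (measurable_fst.prodMk ((measurable_pi_apply m).comp measurable_snd)))
    have e : A = (⋃ m ∈ Iio L, (fun q : Cube d × (ℕ → Fin d → ℝ) =>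
          φ (rosenblattInv (k q.1) (q.2 m))) ⁻¹' W) ∪
        ⋂ m ∈ Iio L, (fun q : Cube d × (ℕ → Fin d → ℝ) =>
          φ (rosenblattInv (k q.1) (q.2 m))) ⁻¹' Iic h := by
      ext q
      simp [hA]
    rw [e]
    exact (MeasurableSet.biUnion (to_countable _) fun m _ => hφY m measurableSet_Ioo).union
      (MeasurableSet.biInter (to_countable _) fun m _ => hφY m measurableSet_Iic)
  have hsec : ∀ j (y : Cube d), P {ω | (y, fun m => u (j * L + m) ω) ∈ A} ≤ c := by
    intro j y
    obtain ⟨m₀, hm₀, hle⟩ :=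
      exists_le_measure_proposal_mem hb hk hκ hkκ hk1 hz hunif hind ha hu j y hBm
    have hYm : Measurable fun ω => rosenblattInv (k y) (u (j * L + m₀) ω) :=
      (measurable_rosenblattInv_single (by fun_prop) hκ (hkκ y)).comp (hum0 _)
    have hsub : {ω | (y, fun m => u (j * L + m) ω) ∈ A} ⊆
        (⋃ m ∈ Finset.range L, {ω | rosenblattInv (k y) (u (j * L + m) ω) ∈ φ ⁻¹' W}) ∪
          {ω | rosenblattInv (k y) (u (j * L + m₀) ω) ∈ {y | h < φ y}}ᶜ := by
      rintro ω (⟨m, hm, hmW⟩ | hall)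
      · exact Or.inl (mem_biUnion (Finset.mem_coe.2 (Finset.mem_range.2 hm)) hmW)
      · exact Or.inr (not_lt.2 (hall m₀ hm₀))
    refine (measure_mono hsub).trans ((measure_union_le _ _).trans (add_le_add ?_ ?_))
    · calc _ ≤ ∑ m ∈ Finset.range L,
            P {ω | rosenblattInv (k y) (u (j * L + m) ω) ∈ φ ⁻¹' W} :=
            measure_biUnion_finset_le _ _
        _ ≤ ∑ m ∈ Finset.range L,
            ((b ^ R : ℕ) : ENNReal) ^ d * (ENNReal.ofReal κ' * volume (φ ⁻¹' W)) :=
            Finset.sum_le_sum fun m _ =>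
              measure_proposal_mem_le hb hk hκ hkκ hk1 hκ' hz hunif hind hu _ y hWm
        _ = Γ * volume (φ ⁻¹' W) := by
            rw [Finset.sum_const, Finset.card_range, nsmul_eq_mul, hΓ]
            ring
        _ ≤ p / 2 := hWvol
    · refine (prob_compl_eq_one_sub (hYm hBm)).trans_le ?_
      exact tsub_le_tsub_left hle 1
  set S : ℕ → Set Ω := fun M => {ω | ∀ n, N ≤ n → n ≤ M → φ (x n ω) ∈ W} with hS
  have hSm : ∀ M, MeasurableSet[pastSigma z (M + 1)] (S M) := by
    intro M
    have e : S M = ⋂ n ∈ Icc N M, x n ⁻¹' (φ ⁻¹' W) := by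
      ext ω
      simp [hS]
    rw [e]
    exact MeasurableSet.biInter (to_countable _) fun n hn =>
      (hxm n).mono (pastSigma_mono (Nat.succ_le_succ hn.2)) le_rfl hWm
  have hstep : ∀ M j, N ≤ M → M + 1 = j * L → P (S (M + L)) ≤ c * P (S M) := by
    intro M j hNM hMj
    set Z : Ω → ℕ → Fin d → ℝ := fun ω m => u (j * L + m) ω with hZ
    have hZm : Measurable Z := measurable_pi_lambda _ fun m => hum0 _
    have hZfut : Measurable[⨆ q ∈ {q : ℕ × Fin d | M + 1 ≤ q.1},
        MeasurableSpace.comap (z q) inferInstance] Z := by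
      refine @measurable_pi_lambda _ _ _ (_) _ _ fun m =>
        @measurable_pi_lambda _ _ _ (_) _ _ fun i => ?_
      simp only [hZ, hu]
      have haff : Measurable fun r : ℝ => (∑ l ∈ Finset.range R,
          ((a (j * L + m) i l : ℕ) : ℝ) / (b : ℝ) ^ (l + 1)) + r / (b : ℝ) ^ R := by
        fun_prop
      refine haff.comp ((comap_measurable (z (j * L + m, i))).mono
        (le_iSup₂_of_le (f := fun q (_ : q ∈ {q : ℕ × Fin d | M + 1 ≤ q.1}) =>
          MeasurableSpace.comap (z q) inferInstance) (j * L + m, i) ?_ le_rfl) le_rfl)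
      exact hMj.le.trans (Nat.le_add_right _ _)
    refine (measure_mono ?_).trans (measure_inter_preimage_le (pastSigma_le hz (M + 1)) hZm
      (indep_pastSigma hz hind (M + 1) hZfut) (hxm M) (hSm M) hAm (hsec j))
    intro ω hω
    refine ⟨fun n h1 h2 => hω n h1 (by omega), ?_⟩
    have := (hx ω).block hv hWh (M := M) (L := L) fun n h1 h2 => hω n (hNM.trans h1) h2
    simpa only [hA, hZ, Set.mem_ofPred_eq, hMj] using this
  -- The inputs of index at least `j * L` act on the trajectory from the point `x (j * L - 1)` on.
  have hpow : ∀ i : ℕ, P (S ((N + 1 + i) * L - 1)) ≤ c ^ i := by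
    intro i
    induction i with
    | zero => simpa using prob_le_one
    | succ i ih =>
      have h1 : N + 1 + i ≤ (N + 1 + i) * L := Nat.le_mul_of_pos_right _ hL0
      have h2 : (N + 1 + (i + 1)) * L - 1 = ((N + 1 + i) * L - 1) + L := by
        rw [show N + 1 + (i + 1) = N + 1 + i + 1 by omega, Nat.succ_mul]
        omega
      rw [h2, pow_succ']
      refine (hstep _ (N + 1 + i) (by omega) (by omega)).trans ?_
      gcongr
  refine le_antisymm (ge_of_tendsto' (ENNReal.tendsto_pow_atTop_nhds_zero_of_lt_one hc1)
    fun i => (measure_mono ?_).trans (hpow i)) zero_le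
  exact fun ω hω n hn _ => hω n hn

end Window

end QMCSA

theorem theorem1 {d : ℕ} (hd : 1 ≤ d)
    -- the objective function
    (φ : QMCSA.Cube d → ℝ) (hφ : Continuous φ)
    (hM : ∃ C : ℝ, ∀ x : QMCSA.Cube d, φ x < (⨆ x', φ x') →
      ∃ M : ℝ, QMCSA.HasMinkowskiContent {x' | φ x' = φ x} M ∧ M ≤ C)
    -- the Markov kernel and its density
    (K : Kernel (QMCSA.Cube d) (QMCSA.Cube d)) [IsMarkovKernel K]
    (k : QMCSA.Cube d → QMCSA.Cube d → ℝ) (hK : QMCSA.IsKernelDensity K k)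
    (hA1 : QMCSA.AssumptionA1 k) (hA2 : QMCSA.AssumptionA2 k)
    -- the input sequences
    {b : ℕ} (hb : 2 ≤ b) (t R : ℕ)
    {Ω : Type*} [MeasurableSpace Ω] (P : Measure Ω) [IsProbabilityMeasure P]
    (u : ℕ → Ω → Fin d → ℝ) (hu : QMCSA.IsTSRSequence P b t R u)
    (v : ℕ → ℝ) (hv : QMCSA.IsTSSequence b 0 (fun n (_ : Fin 1) => v n)) (hv0 : v 0 = 0)
    -- the trajectory, with a cooling schedule that may depend on the past of the trajectory
    (x₀ : QMCSA.Cube d) (T : ℕ → Ω → ℝ) (x : ℕ → Ω → QMCSA.Cube d)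
    (hx : ∀ ω, QMCSA.IsRun φ k x₀ (fun n => u n ω) v (fun n => T n ω) (fun n => x n ω))
    (hTadapted : ∀ n : ℕ,
      Measurable[⨆ i : Fin (n + 1), MeasurableSpace.comap (x i) inferInstance] (T (n + 1)))
    (hT : ∀ᵐ ω ∂P, Summable (fun n : ℕ => T n ω * Real.log n)) :
    ∀ᵐ ω ∂P, Tendsto (fun n => φ (x n ω)) atTop (𝓝 (⨆ x', φ x')) := by
  obtain ⟨C, hM⟩ := hM
  obtain ⟨hk, κ, hκ, hkκ⟩ := hA2
  obtain ⟨a, z, ha, hz, hunif, hind, hu⟩ := hu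
  have hk1 : ∀ y, ∫ y', k y y' = 1 := fun y => by
    have h1 : K y univ = 1 := measure_univ
    rw [(hK y).2, withDensity_apply _ MeasurableSet.univ, Measure.restrict_univ] at h1
    rw [integral_eq_lintegral_of_nonneg_ae (ae_of_all _ (hK y).1)
      (Continuous.aestronglyMeasurable (by fun_prop)), h1, ENNReal.toReal_one]
  have hbdd : BddAbove (range φ) := (isCompact_range hφ).bddAbove
  have hv1 := fun (n : ℕ) (hn : n ≠ 0) => hv.lower_bound hb hv0 hn
  choose! η hη hnull using fun l (hl : l ∈ Iio (⨆ y, φ y)) =>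
    QMCSA.exists_window_null hφ hb hk hκ hkκ hk1 hz hunif hind ha hu
      (fun n hn => (hv1 n hn).2) hx hTadapted hl (QMCSA.volume_level_eq_zero hM hl)
  -- Countably many windows cover the levels below the maximum.
  obtain ⟨D, hDsub, hDc, hcover⟩ := TopologicalSpace.countable_cover_nhdsWithin
    (s := Iio (⨆ y, φ y)) (f := fun l => Ioo (l - η l) (l + η l)) fun l hl =>
      mem_nhdsWithin_of_mem_nhds (Ioo_mem_nhds (by linarith [hη l hl]) (by linarith [hη l hl]))
  have hae : ∀ᵐ ω ∂P, ∀ l ∈ D, ∀ N, ¬ ∀ n, N ≤ n → φ (x n ω) ∈ Ioo (l - η l) (l + η l) := by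
    rw [ae_ball_iff hDc]
    intro l hl
    rw [ae_all_iff]
    intro N
    rw [ae_iff]
    simpa only [not_not] using hnull l (hDsub hl) N
  filter_upwards [hT, hae] with ω hTω hω
  obtain ⟨α, hα⟩ := (hx ω).exists_tendsto hb (fun n hn => (hv1 n hn).1) hTω
    (fun y => le_ciSup hbdd y)
  rcases (le_of_tendsto' hα fun n => le_ciSup hbdd (x n ω)).lt_or_eq with hlt | heq
  · obtain ⟨l, hl, hαl⟩ := mem_iUnion₂.1 (hcover hlt)
    obtain ⟨N, hN⟩ := eventually_atTop.1 (hα.eventually (isOpen_Ioo.mem_nhds hαl))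
    exact absurd hN (hω l hl N)
  · rwa [heq] at hα
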